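/- Let $U=U_{\bar 0}\oplus U_{\bar 1}$ be a finite-dimensional complex vector superspace with a homogeneous basis $A=A_{\bar 0}\cup A_{\bar 1}$, and let $(t_a)_{a\in A}$ be complex numbers. Let $F^{ch}_{N=1}$ be the SUSY charged free fermion vertex algebra associated with $U$. It is the universal $N_K=1$ SUSY vertex algebra (over $\mathbb C$, with odd derivation $D$, $\partial:=D^2$, vacuum $|0\rangle$, and normally ordered product written as juxtaposition) generated by vectors $\phi_a$ of the parity of $a$ and $\phi^{\bar a}$ of the opposite parity ($a\in A$) with the $\Lambda$-brackets $$[\phi_a{}_\Lambda\phi^{\bar b}]=\delta_{ab}|0\rangle,\qquad [\phi_a{}_\Lambda\phi_b]=[\phi^{\bar a}{}_\Lambda\phi^{\bar b}]=0 .$$ Here $\Lambda=(\lambda,\chi)$ with $\lambda$ even, $\chi$ odd, $\chi^2=-\lambda$, and $[a_\Lambda b]=\sum_{j\ge 0}\frac{\lambda^j}{j!}a_{(j|0)}b+\chi\sum_{j\ge0}\frac{\lambda^j}{j!}a_{(j|1)}b$. Put $$T^{ch}_{sh}=\sum_{a\in A_{\bar 0}}\big((t_a+1)\,\partial\phi_a\,\phi^{\bar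 a}+t_a\,\phi_a\,\partial\phi^{\bar a}+D\phi_a\,D\phi^{\bar a}\big)+\sum_{a\in A_{\bar 1}}\big(t_a\,\partial\phi_a\,\phi^{\bar a}+(t_a+1)\,\phi_a\,\partial\phi^{\bar a}+D\phi_a\,D\phi^{\bar a}\big).$$ Then $T=T^{ch}_{sh}$ is an $N=1$ superconformal vector of $F^{ch}_{N=1}$ with central charge $c_{sh}=\sum_{a\in A}(6t_a+3)$; that is, $T$ is odd, $$[T_\Lambda T]=(2\partial+3\lambda+\chi D)T+\tfrac{c_{sh}}{3}\lambda^2\chi\,|0\rangle,$$ $T_{(0|0)}=2\partial$ and $T_{(0|1)}=D$ on $F^{ch}_{N=1}$, and $T_{(1|0)}$ is diagonalizable on $F^{ch}_{N=1}$. Moreover, if $t_a=0$ for all $a\in A$, then $T^{ch}_{sh}$ is the standard vector $$T^{ch}_{st}=\sum_{a\in A_{\bar 0}}\big(\partial\phi_a\,\phi^{\bar a}+D\phi_a\,D\phi^{\bar a}\big)+\sum_{a\in A_{\bar 1}}\big(\phi_a\,\partial\phi^{\bar a}+D\phi_a\,D\phi^{\bar a}\big).$$ -/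

import Mathlib

universe u

/-- The sign `(-1)^p` attached to a parity `p ∈ ℤ/2`. -/
noncomputable def sgn (p : ZMod 2) : ℂ := (-1) ^ p.val

/-- An `N_K = 1` supersymmetric Lie conformal algebra over `ℂ`: a vector superspace
`V = gr 0 ⊕ gr 1` with an odd endomorphism `D` (so that `V` is a module over `ℂ[∂, D]`, where
`∂ = D²`) and a `Λ`-bracket of degree `1`, `Λ = (λ, χ)`, `χ² = -λ`. The bracket is given by its
coefficients
`[a _Λ b] = ∑_j (λ^j / j!) a_(j|0) b + χ ∑_j (λ^j / j!) a_(j|1) b`,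
`br0 j a b = a_(j|0) b`, `br1 j a b = a_(j|1) b`, and every axiom is the comparison of the
coefficients of the monomials `λ^m / m!`, `χ λ^m / m!` (for the Jacobi identity:
`λ^m γ^n / (m! n!)` times `1`, `χ`, `η`, `ηχ`) in the usual identity for the `Λ`-bracket. -/
class SUSYLieConformalAlgebra (V : Type u) [AddCommGroup V] [Module ℂ V] where
  /-- the even part `gr 0` and the odd part `gr 1` -/
  gr : ZMod 2 → Submodule ℂ V
  /-- the odd endomorphism -/
  D : Module.End ℂ V
  /-- `br0 j a b = a_(j|0) b` -/
  br0 : ℕ → V →ₗ[ℂ] V →ₗ[ℂ] V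
  /-- `br1 j a b = a_(j|1) b` -/
  br1 : ℕ → V →ₗ[ℂ] V →ₗ[ℂ] V
  gr_isCompl : IsCompl (gr 0) (gr 1)
  D_mem : ∀ {p : ZMod 2} {a : V}, a ∈ gr p → D a ∈ gr (p + 1)
  br0_mem : ∀ {p q : ZMod 2} {a b : V} (j : ℕ), a ∈ gr p → b ∈ gr q →
    br0 j a b ∈ gr (p + q + 1)
  br1_mem : ∀ {p q : ZMod 2} {a b : V} (j : ℕ), a ∈ gr p → b ∈ gr q →
    br1 j a b ∈ gr (p + q)
  /-- `[a _Λ b]` is a polynomial in `Λ` -/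
  br_finite : ∀ a b : V, ∃ N : ℕ, ∀ j, N ≤ j → br0 j a b = 0 ∧ br1 j a b = 0
  /-- Sesquilinearity `[D a _Λ b] = χ [a _Λ b]`, coefficient of `1` -/
  br0_D_left_zero : ∀ a b : V, br0 0 (D a) b = 0
  /-- Sesquilinearity `[D a _Λ b] = χ [a _Λ b]`, coefficient of `λ^(j+1) / (j+1)!` -/
  br0_D_left_succ : ∀ (j : ℕ) (a b : V), br0 (j + 1) (D a) b = -((j : ℂ) + 1) • br1 j a b
  /-- Sesquilinearity `[D a _Λ b] = χ [a _Λ b]`, coefficient of `χ λ^j / j!` -/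
  br1_D_left : ∀ (j : ℕ) (a b : V), br1 j (D a) b = br0 j a b
  /-- Sesquilinearity `[a _Λ D b] = (-1)^(a+1) (D + χ) [a _Λ b]` with `D χ + χ D = 2 λ`,
  coefficient of `λ^j / j!` (for `j = 0` the last summand vanishes) -/
  br0_D_right : ∀ (j : ℕ) {p : ZMod 2} {a : V} (b : V), a ∈ gr p →
    br0 j a (D b) = sgn (p + 1) • (D (br0 j a b) + (j : ℂ) • br1 (j - 1) a b)
  /-- Sesquilinearity `[a _Λ D b] = (-1)^(a+1) (D + χ) [a _Λ b]`,
  coefficient of `χ λ^j / j!` -/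
  br1_D_right : ∀ (j : ℕ) {p : ZMod 2} {a : V} (b : V), a ∈ gr p →
    br1 j a (D b) = sgn (p + 1) • (br0 j a b - D (br1 j a b))
  /-- Skew-symmetry `[b _Λ a] = (-1)^(ab) [a _{-∇-Λ} b]`, coefficient of `λ^m / m!`;
  `N` is any bound for the degree of `[a _Λ b]` -/
  skew0 : ∀ (m N : ℕ) {p q : ZMod 2} {a b : V}, a ∈ gr p → b ∈ gr q →
    (∀ j, N ≤ j → br0 j a b = 0 ∧ br1 j a b = 0) →
    br0 m b a = sgn (p * q) • ∑ i ∈ Finset.range N, ((-1 : ℂ) ^ (m + i) / (i.factorial : ℂ)) •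
      (D ^ (2 * i)) (br0 (m + i) a b - D (br1 (m + i) a b))
  /-- Skew-symmetry, coefficient of `χ λ^m / m!` -/
  skew1 : ∀ (m N : ℕ) {p q : ZMod 2} {a b : V}, a ∈ gr p → b ∈ gr q →
    (∀ j, N ≤ j → br0 j a b = 0 ∧ br1 j a b = 0) →
    br1 m b a = -sgn (p * q) • ∑ i ∈ Finset.range N, ((-1 : ℂ) ^ (m + i) / (i.factorial : ℂ)) •
      (D ^ (2 * i)) (br1 (m + i) a b)
  /-- Jacobi identity
  `[a _Λ [b _Γ c]] = (-1)^(a+1) [[a _Λ b] _{Λ+Γ} c] + (-1)^((a+1)(b+1)) [b _Γ [a _Λ c]]`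
  with `Λ = (λ, χ)`, `Γ = (γ, η)`, coefficient of `λ^m γ^n / (m! n!)`; here and below `χ` and `η`
  are moved to the left by `[a _Λ η v] = (-1)^(a+1) η [a _Λ v]` and
  `[χ v _Γ c] = -χ [v _Γ c]`, and `χ² = -λ` -/
  jacobi00 : ∀ (m n : ℕ) {p q : ZMod 2} {a b : V} (c : V), a ∈ gr p → b ∈ gr q →
    br0 m a (br0 n b c) =
      sgn (p + 1) • (∑ j ∈ Finset.range (m + 1),
          (m.choose j : ℂ) • br0 (m + n - j) (br0 j a b) c +
        (m : ℂ) • ∑ j ∈ Finset.range m,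
          ((m - 1).choose j : ℂ) • br1 (m - 1 + n - j) (br1 j a b) c) +
      sgn ((p + 1) * (q + 1)) • br0 n b (br0 m a c)
  /-- Jacobi identity, coefficient of `χ λ^m γ^n / (m! n!)` -/
  jacobi10 : ∀ (m n : ℕ) {p q : ZMod 2} {a b : V} (c : V), a ∈ gr p → b ∈ gr q →
    br1 m a (br0 n b c) =
      sgn (p + 1) • ∑ j ∈ Finset.range (m + 1), (m.choose j : ℂ) •
        (br1 (m + n - j) (br0 j a b) c - br0 (m + n - j) (br1 j a b) c) +
      sgn ((p + 1) * (q + 1) + (q + 1)) • br0 n b (br1 m a c)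
  /-- Jacobi identity, coefficient of `η λ^m γ^n / (m! n!)` -/
  jacobi01 : ∀ (m n : ℕ) {p q : ZMod 2} {a b : V} (c : V), a ∈ gr p → b ∈ gr q →
    sgn (p + 1) • br0 m a (br1 n b c) =
      sgn (p + 1) • ∑ j ∈ Finset.range (m + 1), (m.choose j : ℂ) •
        br1 (m + n - j) (br0 j a b) c +
      sgn ((p + 1) * (q + 1)) • br1 n b (br0 m a c)
  /-- Jacobi identity, coefficient of `ηχ λ^m γ^n / (m! n!)` -/
  jacobi11 : ∀ (m n : ℕ) {p q : ZMod 2} {a b : V} (c : V), a ∈ gr p → b ∈ gr q →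
    sgn (p + 1) • br1 m a (br1 n b c) =
      sgn (p + 1) • ∑ j ∈ Finset.range (m + 1), (m.choose j : ℂ) •
        br1 (m + n - j) (br1 j a b) c +
      sgn ((p + 1) * (q + 1) + (q + 1) + 1) • br1 n b (br1 m a c)

/-- An `N_K = 1` supersymmetric vertex algebra: an `N_K = 1` SUSY Lie conformal algebra with an
even vacuum vector `vac` and an even (normally ordered) product `mul`, which is unital, for which
`D` is an odd derivation, and which satisfies quasi-commutativity, quasi-associativity and the
non-commutative Wick formula. Integrals are `∫ dΛ = ∂_χ ∫ dλ`. -/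
class SUSYVertexAlgebra (V : Type u) [AddCommGroup V] [Module ℂ V] extends
    SUSYLieConformalAlgebra V where
  /-- the vacuum vector -/
  vac : V
  /-- the normally ordered product -/
  mul : V →ₗ[ℂ] V →ₗ[ℂ] V
  vac_mem : vac ∈ gr 0
  mul_mem : ∀ {p q : ZMod 2} {a b : V}, a ∈ gr p → b ∈ gr q → mul a b ∈ gr (p + q)
  vac_mul : ∀ a : V, mul vac a = a
  mul_vac : ∀ a : V, mul a vac = a
  D_mul : ∀ {p : ZMod 2} {a : V} (b : V), a ∈ gr p →
    D (mul a b) = mul (D a) b + sgn p • mul a (D b)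
  /-- `ab - (-1)^(ab) ba = ∫_{-∇}^0 [a _Λ b] dΛ` -/
  quasi_comm : ∀ (N : ℕ) {p q : ZMod 2} {a b : V}, a ∈ gr p → b ∈ gr q →
    (∀ j, N ≤ j → br1 j a b = 0) →
    mul a b - sgn (p * q) • mul b a = ∑ j ∈ Finset.range N,
      ((-1 : ℂ) ^ j / ((j + 1).factorial : ℂ)) • (D ^ (2 * (j + 1))) (br1 j a b)
  /-- `(ab)c - a(bc) = (∫_0^∇ dΛ a) [b _Λ c] + (-1)^(ab) (∫_0^∇ dΛ b) [a _Λ c]` -/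
  quasi_assoc : ∀ (N : ℕ) {p q : ZMod 2} {a b : V} (c : V), a ∈ gr p → b ∈ gr q →
    (∀ j, N ≤ j → br1 j b c = 0) → (∀ j, N ≤ j → br1 j a c = 0) →
    mul (mul a b) c - mul a (mul b c) =
      ∑ j ∈ Finset.range N, (((j + 1).factorial : ℂ))⁻¹ •
        mul ((D ^ (2 * (j + 1))) a) (br1 j b c) +
      sgn (p * q) • ∑ j ∈ Finset.range N, (((j + 1).factorial : ℂ))⁻¹ •
        mul ((D ^ (2 * (j + 1))) b) (br1 j a c)
  /-- Wick formula
  `[a _Λ bc] = [a _Λ b]c + (-1)^((a+1)b) b[a _Λ c] + ∫_0^Λ [[a _Λ b] _Γ c] dΓ`,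
  coefficient of `λ^m / m!` -/
  wick0 : ∀ (m : ℕ) {p q : ZMod 2} {a b : V} (c : V), a ∈ gr p → b ∈ gr q →
    br0 m a (mul b c) = mul (br0 m a b) c + sgn ((p + 1) * q) • mul b (br0 m a c) +
      ∑ j ∈ Finset.range m, (m.choose j : ℂ) • br1 (m - 1 - j) (br0 j a b) c
  /-- Wick formula, coefficient of `χ λ^m / m!` (with `b χ = (-1)^b χ b`) -/
  wick1 : ∀ (m : ℕ) {p q : ZMod 2} {a b : V} (c : V), a ∈ gr p → b ∈ gr q →
    br1 m a (mul b c) = mul (br1 m a b) c + sgn (p * q) • mul b (br1 m a c) +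
      ∑ j ∈ Finset.range m, (m.choose j : ℂ) • br1 (m - 1 - j) (br1 j a b) c

namespace SUSYVertexAlgebra

open SUSYLieConformalAlgebra

/-- The even translation operator `∂ = D²`. -/
def del {V : Type u} [AddCommGroup V] [Module ℂ V] [SUSYLieConformalAlgebra V] :
    Module.End ℂ V := D * D

/-- `T` is an `N = 1` superconformal vector of central charge `c`. -/
structure IsSuperconformalVector {V : Type u} [AddCommGroup V] [Module ℂ V]
    [SUSYVertexAlgebra V] (T : V) (c : ℂ) : Prop where
  /-- `T` is odd -/
  odd : T ∈ gr (1 : ZMod 2)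
  /-- `[T _Λ T] = (2∂ + 3λ + χD) T + (c/3) λ²χ`, coefficients of `λ^j / j!` -/
  bracket0 : ∀ j : ℕ, br0 j T T =
    if j = 0 then (2 : ℂ) • del T else if j = 1 then (3 : ℂ) • T else 0
  /-- `[T _Λ T] = (2∂ + 3λ + χD) T + (c/3) λ²χ`, coefficients of `χ λ^j / j!` -/
  bracket1 : ∀ j : ℕ, br1 j T T =
    if j = 0 then D T else if j = 2 then (2 * (c / 3)) • (vac : V) else 0
  /-- `T_(0|0) = 2∂` -/
  mode00 : br0 0 T = (2 : ℂ) • del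
  /-- `T_(0|1) = D` -/
  mode01 : br1 0 T = D
  /-- `T_(1|0)` is diagonalizable: `V` is the sum of its eigenspaces -/
  diagonalizable : ⨆ μ : ℂ, Module.End.eigenspace (br0 1 T) μ = ⊤

/-- A charged free fermion system in a SUSY vertex algebra `W`, indexed by a set `A` with parity
`par`: vectors `φ a` of parity `a` and `ψ a` (standing for `φ^ā`) of parity `a + 1` with
`[φ_a _Λ φ^b̄] = δ_ab`, `[φ_a _Λ φ_b] = [φ^ā _Λ φ^b̄] = 0`. Equivalently, a homomorphism of SUSY
Lie conformal algebras to `W` from the free `ℂ[∂, D]`-module on the symbols `φ_a`, `φ^ā`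
(extended by the constants, which go to multiples of the vacuum) with these brackets. -/
structure IsChargedFree {A : Type u} (par : A → ZMod 2) {W : Type u} [AddCommGroup W]
    [Module ℂ W] [SUSYVertexAlgebra W] (φ ψ : A → W) : Prop where
  φ_mem : ∀ a, φ a ∈ gr (par a)
  ψ_mem : ∀ a, ψ a ∈ gr (par a + 1)
  φψ_same : ∀ a j, br0 j (φ a) (ψ a) = if j = 0 then vac else 0
  φψ_ne : ∀ a b j, a ≠ b → br0 j (φ a) (ψ b) = 0
  φψ_br1 : ∀ a b j, br1 j (φ a) (ψ b) = 0
  φφ : ∀ a b j, br0 j (φ a) (φ b) = 0 ∧ br1 j (φ a) (φ b) = 0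
  ψψ : ∀ a b j, br0 j (ψ a) (ψ b) = 0 ∧ br1 j (ψ a) (ψ b) = 0

/-- A homomorphism of SUSY vertex algebras. -/
structure IsHom {V W : Type u} [AddCommGroup V] [Module ℂ V] [SUSYVertexAlgebra V]
    [AddCommGroup W] [Module ℂ W] [SUSYVertexAlgebra W] (f : V →ₗ[ℂ] W) : Prop where
  map_gr : ∀ {p : ZMod 2} {x : V}, x ∈ gr p → f x ∈ gr p
  map_vac : f vac = vac
  map_D : ∀ x, f (D x) = D (f x)
  map_mul : ∀ x y, f (mul x y) = mul (f x) (f y)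
  map_br0 : ∀ j x y, f (br0 j x y) = br0 j (f x) (f y)
  map_br1 : ∀ j x y, f (br1 j x y) = br1 j (f x) (f y)

/-! ### Words in a charged free fermion system

The subspace generated by a charged free fermion system is filtered by a weight for which
the generators have weight `1`, `D` adds `2`, and `a_(j|k) b` has weight at most
`wt a + wt b - 2 - 4j - 2k`. This bounds the degree of the `Λ`-brackets uniformly. -/

section Words

variable {A W : Type u} [AddCommGroup W] [Module ℂ W] [SUSYVertexAlgebra W]

theorem D_vac : D (vac : W) = 0 := by
  have h := D_mul (p := 0) (a := (vac : W)) vac vac_mem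
  rw [vac_mul, mul_vac, vac_mul] at h
  simpa [sgn] using h

theorem br0_vac_left (j : ℕ) (b : W) : br0 j vac b = 0 := by
  rw [← br1_D_left, D_vac]; simp

theorem br1_vac_left (j : ℕ) (b : W) : br1 j vac b = 0 := by
  have h := br0_D_left_succ j (vac : W) b
  rw [D_vac] at h
  simp only [map_zero, LinearMap.zero_apply] at h
  have h2 : ((j : ℂ) + 1) ≠ 0 := by exact_mod_cast Nat.succ_ne_zero j
  rcases smul_eq_zero.1 h.symm with h | h
  · exact absurd (neg_eq_zero.1 h) h2
  · exact h

theorem br_vac_right (j : ℕ) {p : ZMod 2} {a : W} (ha : a ∈ gr p) :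
    br0 j a vac = 0 ∧ br1 j a vac = 0 := by
  have h : ∀ j, 0 ≤ j → br0 j (vac : W) a = 0 ∧ br1 j (vac : W) a = 0 :=
    fun j _ => ⟨br0_vac_left j a, br1_vac_left j a⟩
  have h0 := skew0 j 0 vac_mem ha h
  have h1 := skew1 j 0 vac_mem ha h
  constructor
  · simpa using h0
  · simpa using h1

theorem D_pow_mem {p : ZMod 2} {a : W} (ha : a ∈ gr p) (e : ℕ) :
    ∃ q : ZMod 2, (D ^ e) a ∈ gr q := by
  induction e with
  | zero => exact ⟨p, by simpa using ha⟩
  | succ e ih =>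
    obtain ⟨q, hq⟩ := ih
    exact ⟨q + 1, by rw [pow_succ']; exact D_mem hq⟩

/-- The letters: derivatives `D^e φ_a`, `D^e φ^ā`, of weight `1 + 2e`. -/
inductive IsLetter (φ ψ : A → W) : ℤ → W → Prop
  | fst (e : ℕ) (a : A) : IsLetter φ ψ (1 + 2 * e) ((D ^ e) (φ a))
  | snd (e : ℕ) (a : A) : IsLetter φ ψ (1 + 2 * e) ((D ^ e) (ψ a))

/-- Right-nested normally ordered words, with their length and weight. -/
inductive IsWord (φ ψ : A → W) : ℕ → ℤ → W → Prop
  | nil : IsWord φ ψ 0 0 vac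
  | cons {l : ℕ} {p n : ℤ} {x w : W} (hx : IsLetter φ ψ p x) (hw : IsWord φ ψ l n w) :
      IsWord φ ψ (l + 1) (p + n) (mul x w)

/-- The span of the words of length at most `l` and weight at most `n`. -/
def fil (φ ψ : A → W) (l n : ℤ) : Submodule ℂ W :=
  Submodule.span ℂ {w | ∃ (l' : ℕ) (n' : ℤ), (l' : ℤ) ≤ l ∧ n' ≤ n ∧ IsWord φ ψ l' n' w}

variable {par : A → ZMod 2} {φ ψ : A → W}

theorem fil_mono {l l' n n' : ℤ} (hl : l ≤ l') (hn : n ≤ n') : fil φ ψ l n ≤ fil φ ψ l' n' := by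
  apply Submodule.span_mono
  rintro w ⟨a, b, ha, hb, hw⟩
  exact ⟨a, b, ha.trans hl, hb.trans hn, hw⟩

theorem fil_cast {l l' n n' : ℤ} {w : W} (h : w ∈ fil φ ψ l n) (hl : l ≤ l') (hn : n ≤ n') :
    w ∈ fil φ ψ l' n' := fil_mono hl hn h

theorem IsWord.mem {l : ℕ} {n : ℤ} {w : W} (h : IsWord φ ψ l n w) : w ∈ fil φ ψ l n :=
  Submodule.subset_span ⟨l, n, le_rfl, le_rfl, h⟩

theorem IsLetter.weight_pos {p : ℤ} {x : W} (h : IsLetter φ ψ p x) : 0 < p := by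
  cases h <;> positivity

theorem IsWord.weight_nonneg {l : ℕ} {n : ℤ} {w : W} (h : IsWord φ ψ l n w) : 0 ≤ n := by
  induction h with
  | nil => exact le_rfl
  | cons hx _ ih => have := hx.weight_pos; omega

theorem fil_neg {l n : ℤ} (hn : n < 0) {w : W} (hw : w ∈ fil φ ψ l n) : w = 0 := by
  have : {w | ∃ (l' : ℕ) (n' : ℤ), (l' : ℤ) ≤ l ∧ n' ≤ n ∧ IsWord φ ψ l' n' w} = ∅ := by
    ext w
    simp only [Set.mem_ofPred_eq, Set.mem_empty_iff_false, iff_false]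
    rintro ⟨l', n', _, h2, h3⟩
    have := h3.weight_nonneg
    omega
  rw [fil, this, Submodule.span_empty] at hw
  simpa using hw

/-- To check that a linear map sends `fil l n` to a subspace it suffices to look at words. -/
theorem fil_induction {l n : ℤ} {S : Submodule ℂ W} (f : W →ₗ[ℂ] W)
    (h : ∀ (l' : ℕ) (n' : ℤ) (w : W), (l' : ℤ) ≤ l → n' ≤ n → IsWord φ ψ l' n' w → f w ∈ S)
    {w : W} (hw : w ∈ fil φ ψ l n) : f w ∈ S := by
  have : fil φ ψ l n ≤ S.comap f := by
    apply Submodule.span_le.2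
    rintro w ⟨l', n', h1, h2, h3⟩
    exact h l' n' w h1 h2 h3
  exact this hw

theorem IsLetter.homog (H : IsChargedFree par φ ψ) {p : ℤ} {x : W} (h : IsLetter φ ψ p x) :
    ∃ q : ZMod 2, x ∈ gr q := by
  cases h with
  | fst e a => exact D_pow_mem (H.φ_mem a) e
  | snd e a => exact D_pow_mem (H.ψ_mem a) e

theorem IsLetter.D {p : ℤ} {x : W} (h : IsLetter φ ψ p x) : IsLetter φ ψ (p + 2) (D x) := by
  cases h with
  | fst e a =>
    have := IsLetter.fst (φ := φ) (ψ := ψ) (e + 1) a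
    rw [pow_succ'] at this
    convert this using 1 <;> rfl
  | snd e a =>
    have := IsLetter.snd (φ := φ) (ψ := ψ) (e + 1) a
    rw [pow_succ'] at this
    convert this using 1 <;> rfl

theorem IsWord.homog (H : IsChargedFree par φ ψ) {l : ℕ} {n : ℤ} {w : W}
    (h : IsWord φ ψ l n w) : ∃ q : ZMod 2, w ∈ gr q := by
  induction h with
  | nil => exact ⟨0, vac_mem⟩
  | cons hx _ ih =>
    obtain ⟨p, hp⟩ := hx.homog H
    obtain ⟨q, hq⟩ := ih
    exact ⟨p + q, mul_mem hp hq⟩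

theorem letter_mul {p l n : ℤ} {x w : W} (hx : IsLetter φ ψ p x) (hw : w ∈ fil φ ψ l n) :
    mul x w ∈ fil φ ψ (l + 1) (p + n) := by
  refine fil_induction (mul x) ?_ hw
  intro l' n' w h1 h2 h3
  exact fil_cast (IsWord.cons hx h3).mem (by push_cast; omega) (by omega)

theorem D_fil (H : IsChargedFree par φ ψ) {l n : ℤ} {w : W} (hw : w ∈ fil φ ψ l n) :
    D w ∈ fil φ ψ l (n + 2) := by
  refine fil_induction (SUSYLieConformalAlgebra.D) ?_ hw
  intro l' n' w h1 h2 h3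
  suffices h : D w ∈ fil φ ψ l' (n' + 2) from fil_cast h h1 (by omega)
  clear h1 h2 hw
  induction h3 with
  | nil => rw [D_vac]; exact Submodule.zero_mem _
  | @cons l p n x w hx hw ih =>
    obtain ⟨q, hq⟩ := hx.homog H
    rw [D_mul _ hq]
    refine Submodule.add_mem _ ?_ (Submodule.smul_mem _ _ ?_)
    · exact fil_cast (letter_mul hx.D hw.mem) (by push_cast; omega) (by omega)
    · exact fil_cast (letter_mul hx ih) (by push_cast; omega) (by omega)

theorem D_pow_fil (H : IsChargedFree par φ ψ) (e : ℕ) {l n : ℤ} {w : W}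
    (hw : w ∈ fil φ ψ l n) : (D ^ e) w ∈ fil φ ψ l (n + 2 * e) := by
  induction e with
  | zero => simpa using hw
  | succ e ih =>
    rw [pow_succ']
    exact fil_cast (D_fil H ih) le_rfl (by push_cast; omega)

theorem fil_zero_mul {m l n : ℤ} {z w : W} (hz : z ∈ fil φ ψ 0 m) (hw : w ∈ fil φ ψ l n) :
    mul z w ∈ fil φ ψ l (m + n) := by
  refine fil_induction (mul.flip w) ?_ hz
  intro l' n' z h1 h2 h3
  cases h3 with
  | nil => simpa [vac_mul] using fil_cast hw le_rfl (by omega)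
  | cons hx hw => push_cast at h1; omega

theorem fil_zero_br1 {m : ℤ} {z : W} (hz : z ∈ fil φ ψ 0 m) (j : ℕ) (w : W) :
    br1 j z w = 0 := by
  have : ((br1 j).flip w) z ∈ (⊥ : Submodule ℂ W) := by
    refine fil_induction ((br1 j).flip w) ?_ hz
    intro l' n' z h1 h2 h3
    cases h3 with
    | nil => simp [br1_vac_left]
    | cons hx hw => push_cast at h1; omega
  simpa using this

/-- All brackets `a_(j|k) b` lie in `fil l (M - 4j - 2k)`. -/
def BrIn (φ ψ : A → W) (l M : ℤ) (a b : W) : Prop :=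
  ∀ j : ℕ, br0 j a b ∈ fil φ ψ l (M - 4 * j) ∧ br1 j a b ∈ fil φ ψ l (M - 4 * j - 2)

theorem BrIn.bound {l M : ℤ} {a b : W} (h : BrIn φ ψ l M a b) (j : ℕ) (hj : M.toNat + 1 ≤ j) :
    br0 j a b = 0 ∧ br1 j a b = 0 :=
  ⟨fil_neg (by omega) (h j).1, fil_neg (by omega) (h j).2⟩

theorem BrIn.cast {l M l' M' : ℤ} {a b : W} (h : BrIn φ ψ l M a b) (hl : l ≤ l') (hM : M ≤ M') :
    BrIn φ ψ l' M' a b :=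
  fun j => ⟨fil_cast (h j).1 hl (by omega), fil_cast (h j).2 hl (by omega)⟩

theorem BrIn.skew (H : IsChargedFree par φ ψ) {l M : ℤ} {a b : W} {p q : ZMod 2}
    (ha : a ∈ gr p) (hb : b ∈ gr q) (h : BrIn φ ψ l M a b) : BrIn φ ψ l M b a := by
  intro j
  constructor
  · rw [skew0 j (M.toNat + 1) ha hb h.bound]
    refine Submodule.smul_mem _ _ (Submodule.sum_mem _ fun i _ => Submodule.smul_mem _ _ ?_)
    refine fil_cast (D_pow_fil H (2 * i) (n := M - 4 * j - 4 * i)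
      (Submodule.sub_mem _ ?_ ?_)) le_rfl (by push_cast; omega)
    · exact fil_cast (h (j + i)).1 le_rfl (by push_cast; omega)
    · exact fil_cast (D_fil H (h (j + i)).2) le_rfl (by push_cast; omega)
  · rw [skew1 j (M.toNat + 1) ha hb h.bound]
    refine Submodule.smul_mem _ _ (Submodule.sum_mem _ fun i _ => Submodule.smul_mem _ _ ?_)
    refine fil_cast (D_pow_fil H (2 * i) (n := M - 4 * j - 4 * i - 2) ?_) le_rfl
      (by push_cast; omega)
    exact fil_cast (h (j + i)).2 le_rfl (by push_cast; omega)

theorem BrIn.D_left {M : ℤ} {a b : W} (h : BrIn φ ψ 0 M a b) : BrIn φ ψ 0 (M + 2) (D a) b := by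
  intro j
  constructor
  · cases j with
    | zero => rw [br0_D_left_zero]; exact Submodule.zero_mem _
    | succ j =>
      rw [br0_D_left_succ]
      exact Submodule.smul_mem _ _ (fil_cast (h j).2 le_rfl (by push_cast; omega))
  · rw [br1_D_left]
    exact fil_cast (h j).1 le_rfl (by omega)

theorem BrIn.D_right (H : IsChargedFree par φ ψ) {M : ℤ} {a b : W} {p : ZMod 2}
    (ha : a ∈ gr p) (h : BrIn φ ψ 0 M a b) : BrIn φ ψ 0 (M + 2) a (D b) := by
  intro j
  constructor
  · rw [br0_D_right j b ha]
    refine Submodule.smul_mem _ _ (Submodule.add_mem _ ?_ ?_)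
    · exact fil_cast (D_fil H (h j).1) le_rfl (by omega)
    · cases j with
      | zero => simp
      | succ j =>
        exact Submodule.smul_mem _ _ (fil_cast (h j).2 le_rfl (by push_cast; omega))
  · rw [br1_D_right j b ha]
    refine Submodule.smul_mem _ _ (Submodule.sub_mem _ ?_ ?_)
    · exact fil_cast (h j).1 le_rfl (by omega)
    · exact fil_cast (D_fil H (h j).2) le_rfl (by omega)

theorem BrIn.D_pow (H : IsChargedFree par φ ψ) {a b : W} {p : ZMod 2}
    (ha : a ∈ gr p) (h : BrIn φ ψ 0 0 a b) (e f : ℕ) :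
    BrIn φ ψ 0 (2 * e + 2 * f) ((D ^ e) a) ((D ^ f) b) := by
  induction f with
  | zero =>
    induction e with
    | zero => simpa using h
    | succ e ih =>
      rw [pow_succ']
      exact (BrIn.D_left ih).cast le_rfl (by push_cast; omega)
  | succ f ih =>
    obtain ⟨q, hq⟩ := D_pow_mem ha e
    rw [pow_succ' _ f]
    exact (BrIn.D_right H hq ih).cast le_rfl (by push_cast; omega)

theorem BrIn.letters (H : IsChargedFree par φ ψ) {p q : ℤ} {x y : W}
    (hx : IsLetter φ ψ p x) (hy : IsLetter φ ψ q y) : BrIn φ ψ 0 (p + q - 2) x y := by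
  have hvac : (vac : W) ∈ fil φ ψ 0 0 := by simpa using (IsWord.nil (φ := φ) (ψ := ψ)).mem
  have h12 : ∀ a b, BrIn φ ψ 0 0 (φ a) (ψ b) := by
    intro a b j
    refine ⟨?_, by rw [H.φψ_br1]; exact Submodule.zero_mem _⟩
    by_cases hab : a = b
    · subst hab
      rw [H.φψ_same]
      split_ifs with hj
      · subst hj; simpa using hvac
      · exact Submodule.zero_mem _
    · rw [H.φψ_ne a b j hab]; exact Submodule.zero_mem _
  have h11 : ∀ a b, BrIn φ ψ 0 0 (φ a) (φ b) := by
    intro a b j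
    rw [(H.φφ a b j).1, (H.φφ a b j).2]
    exact ⟨Submodule.zero_mem _, Submodule.zero_mem _⟩
  have h22 : ∀ a b, BrIn φ ψ 0 0 (ψ a) (ψ b) := by
    intro a b j
    rw [(H.ψψ a b j).1, (H.ψψ a b j).2]
    exact ⟨Submodule.zero_mem _, Submodule.zero_mem _⟩
  have h21 : ∀ a b, BrIn φ ψ 0 0 (ψ a) (φ b) := fun a b =>
    (h12 b a).skew H (H.φ_mem b) (H.ψ_mem a)
  cases hx with
  | fst e a =>
    cases hy with
    | fst f b => exact (BrIn.D_pow H (H.φ_mem a) (h11 a b) e f).cast le_rfl (by omega)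
    | snd f b => exact (BrIn.D_pow H (H.φ_mem a) (h12 a b) e f).cast le_rfl (by omega)
  | snd e a =>
    cases hy with
    | fst f b => exact (BrIn.D_pow H (H.ψ_mem a) (h21 a b) e f).cast le_rfl (by omega)
    | snd f b => exact (BrIn.D_pow H (H.ψ_mem a) (h22 a b) e f).cast le_rfl (by omega)

theorem BrIn.of_words {l n l' M : ℤ} {x : W}
    (h : ∀ (k : ℕ) (m : ℤ) (w : W), (k : ℤ) ≤ l → m ≤ n → IsWord φ ψ k m w → BrIn φ ψ l' M x w)
    {w : W} (hw : w ∈ fil φ ψ l n) : BrIn φ ψ l' M x w := fun j =>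
  ⟨fil_induction (br0 j x) (fun k m w h1 h2 h3 => (h k m w h1 h2 h3 j).1) hw,
    fil_induction (br1 j x) (fun k m w h1 h2 h3 => (h k m w h1 h2 h3 j).2) hw⟩

theorem BrIn.of_words_left {l n l' M : ℤ} {x : W}
    (h : ∀ (k : ℕ) (m : ℤ) (w : W), (k : ℤ) ≤ l → m ≤ n → IsWord φ ψ k m w → BrIn φ ψ l' M w x)
    {w : W} (hw : w ∈ fil φ ψ l n) : BrIn φ ψ l' M w x := fun j =>
  ⟨fil_induction ((br0 j).flip x) (fun k m w h1 h2 h3 => (h k m w h1 h2 h3 j).1) hw,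
    fil_induction ((br1 j).flip x) (fun k m w h1 h2 h3 => (h k m w h1 h2 h3 j).2) hw⟩

theorem BrIn.letter_word (H : IsChargedFree par φ ψ) {p : ℤ} {x : W}
    (hx : IsLetter φ ψ p x) {l : ℕ} {n : ℤ} {w : W} (hw : IsWord φ ψ l n w) :
    BrIn φ ψ ((l : ℤ) - 1) (p + n - 2) x w := by
  obtain ⟨q, hq⟩ := hx.homog H
  induction hw with
  | nil =>
    intro j
    rw [(br_vac_right j hq).1, (br_vac_right j hq).2]
    exact ⟨Submodule.zero_mem _, Submodule.zero_mem _⟩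
  | @cons l r n y w hy hw ih =>
    obtain ⟨s, hs⟩ := hy.homog H
    have hxy := BrIn.letters H hx hy
    intro j
    constructor
    · rw [wick0 j w hq hs]
      refine Submodule.add_mem _ (Submodule.add_mem _ ?_ (Submodule.smul_mem _ _ ?_)) ?_
      · exact fil_cast (fil_zero_mul (hxy j).1 hw.mem) (by push_cast; omega) (by omega)
      · exact fil_cast (letter_mul hy (ih j).1) (by push_cast; omega) (by omega)
      · refine Submodule.sum_mem _ fun i _ => ?_
        rw [fil_zero_br1 (hxy i).1]; simp
    · rw [wick1 j w hq hs]
      refine Submodule.add_mem _ (Submodule.add_mem _ ?_ (Submodule.smul_mem _ _ ?_)) ?_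
      · exact fil_cast (fil_zero_mul (hxy j).2 hw.mem) (by push_cast; omega) (by omega)
      · exact fil_cast (letter_mul hy (ih j).2) (by push_cast; omega) (by omega)
      · refine Submodule.sum_mem _ fun i _ => ?_
        rw [fil_zero_br1 (hxy i).2]; simp

theorem BrIn.words (H : IsChargedFree par φ ψ) (L : ℕ) :
    ∀ (l k : ℕ) (m n : ℤ) (a c : W), l + k ≤ L → IsWord φ ψ l m a → IsWord φ ψ k n c →
      BrIn φ ψ ((l : ℤ) + k) (m + n - 2) a c ∧ mul a c ∈ fil φ ψ ((l : ℤ) + k) (m + n) := by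
  induction L with
  | zero =>
    intro l k m n a c hL ha hc
    cases ha with
    | cons _ _ => omega
    | nil =>
      refine ⟨fun j => ?_, ?_⟩
      · rw [br0_vac_left, br1_vac_left]
        exact ⟨Submodule.zero_mem _, Submodule.zero_mem _⟩
      · rw [vac_mul]; simpa using hc.mem
  | succ L IH =>
    -- the induction hypothesis, extended from words to their spans
    have IHb : ∀ (l k : ℤ) (m n : ℤ) (a c : W), l + k ≤ L → a ∈ fil φ ψ l m →
        c ∈ fil φ ψ k n → BrIn φ ψ (l + k) (m + n - 2) a c := by
      intro l k m n a c hL ha hc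
      refine BrIn.of_words_left (fun l' m' a' h1 h2 h3 => ?_) ha
      refine BrIn.of_words (fun k' n' c' h4 h5 h6 => ?_) hc
      exact (IH l' k' m' n' a' c' (by omega) h3 h6).1.cast (by omega) (by omega)
    have IHm : ∀ (l k : ℤ) (m n : ℤ) (a c : W), l + k ≤ L → a ∈ fil φ ψ l m →
        c ∈ fil φ ψ k n → mul a c ∈ fil φ ψ (l + k) (m + n) := by
      intro l k m n a c hL ha hc
      refine fil_induction (mul.flip c) (fun l' m' a' h1 h2 h3 => ?_) ha
      refine fil_induction (mul a') (fun k' n' c' h4 h5 h6 => ?_) hc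
      exact fil_cast (IH l' k' m' n' a' c' (by omega) h3 h6).2 (by omega) (by omega)
    intro l k m n a c hL ha hc
    cases ha with
    | nil =>
      refine ⟨fun j => ?_, ?_⟩
      · rw [br0_vac_left, br1_vac_left]
        exact ⟨Submodule.zero_mem _, Submodule.zero_mem _⟩
      · rw [vac_mul]; simpa using hc.mem
    | @cons l p m x w hx hw =>
      obtain ⟨r, hr⟩ := hx.homog H
      obtain ⟨s, hs⟩ := hw.homog H
      obtain ⟨q, hq⟩ := hc.homog H
      have hxc := BrIn.letter_word H hx hc
      have hcx := hxc.skew H hr hq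
      have hwc : BrIn φ ψ ((l : ℤ) + k) (m + n - 2) w c :=
        (IH l k m n w c (by omega) hw hc).1
      have hcw : BrIn φ ψ ((k : ℤ) + l) (n + m - 2) c w :=
        (IH k l n m c w (by omega) hc hw).1
      constructor
      · refine BrIn.skew H hq (mul_mem hr hs) fun j => ⟨?_, ?_⟩
        · rw [wick0 j w hq hr]
          refine Submodule.add_mem _ (Submodule.add_mem _ ?_ (Submodule.smul_mem _ _ ?_)) ?_
          · exact fil_cast (IHm _ _ _ _ _ _ (by omega) (hcx j).1 hw.mem) (by push_cast; omega)
              (by omega)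
          · exact fil_cast (letter_mul hx (hcw j).1) (by push_cast; omega) (by omega)
          · refine Submodule.sum_mem _ fun i hi => Submodule.smul_mem _ _ ?_
            have hi' := Finset.mem_range.1 hi
            exact fil_cast (IHb _ _ _ _ _ _ (by omega) (hcx i).1 hw.mem (j - 1 - i)).2
              (by push_cast; omega) (by omega)
        · rw [wick1 j w hq hr]
          refine Submodule.add_mem _ (Submodule.add_mem _ ?_ (Submodule.smul_mem _ _ ?_)) ?_
          · exact fil_cast (IHm _ _ _ _ _ _ (by omega) (hcx j).2 hw.mem) (by push_cast; omega)
              (by omega)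
          · exact fil_cast (letter_mul hx (hcw j).2) (by push_cast; omega) (by omega)
          · refine Submodule.sum_mem _ fun i hi => Submodule.smul_mem _ _ ?_
            have hi' := Finset.mem_range.1 hi
            exact fil_cast (IHb _ _ _ _ _ _ (by omega) (hcx i).2 hw.mem (j - 1 - i)).2
              (by push_cast; omega) (by omega)
      · have h := quasi_assoc (max ((m + n - 2).toNat + 1) ((p + n - 2).toNat + 1)) c hr hs
          (fun j hj => (hwc.bound j (le_trans (le_max_left _ _) hj)).2)
          (fun j hj => (hxc.bound j (le_trans (le_max_right _ _) hj)).2)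
        rw [sub_eq_iff_eq_add] at h
        rw [h]
        refine Submodule.add_mem _ (Submodule.add_mem _ ?_ (Submodule.smul_mem _ _ ?_)) ?_
        · refine Submodule.sum_mem _ fun j _ => Submodule.smul_mem _ _ ?_
          have hy : ∀ e : ℕ, IsLetter φ ψ (p + 2 * e) ((SUSYLieConformalAlgebra.D ^ e) x) := by
            intro e
            induction e with
            | zero => simpa using hx
            | succ e ih =>
              rw [pow_succ']
              convert ih.D using 1 <;> first | rfl | (push_cast; ring)
          exact fil_cast (letter_mul (hy (2 * (j + 1))) (hwc j).2) (by push_cast; omega)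
            (by push_cast; omega)
        · refine Submodule.sum_mem _ fun j _ => Submodule.smul_mem _ _ ?_
          exact fil_cast (IHm _ _ _ _ _ _ (by omega) (D_pow_fil H (2 * (j + 1)) hw.mem)
            (hxc j).2) (by push_cast; omega) (by push_cast; omega)
        · exact fil_cast (letter_mul hx (IH l k m n w c (by omega) hw hc).2)
            (by push_cast; omega) (by omega)

theorem BrIn.fil (H : IsChargedFree par φ ψ) {l k m n : ℤ} {a c : W}
    (ha : a ∈ fil φ ψ l m) (hc : c ∈ fil φ ψ k n) : BrIn φ ψ (l + k) (m + n - 2) a c := by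
  refine BrIn.of_words_left (fun l' m' a' h1 h2 h3 => ?_) ha
  refine BrIn.of_words (fun k' n' c' h4 h5 h6 => ?_) hc
  exact (BrIn.words H _ l' k' m' n' a' c' le_rfl h3 h6).1.cast (by omega) (by omega)

theorem mul_fil (H : IsChargedFree par φ ψ) {l k m n : ℤ} {a c : W}
    (ha : a ∈ SUSYVertexAlgebra.fil φ ψ l m) (hc : c ∈ SUSYVertexAlgebra.fil φ ψ k n) :
    mul a c ∈ SUSYVertexAlgebra.fil φ ψ (l + k) (m + n) := by
  refine fil_induction (mul.flip c) (fun l' m' a' h1 h2 h3 => ?_) ha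
  refine fil_induction (mul a') (fun k' n' c' h4 h5 h6 => ?_) hc
  exact fil_cast (BrIn.words H _ l' k' m' n' a' c' le_rfl h3 h6).2 (by omega) (by omega)

end Words

/-! ### The SUSY charged free fermion vertex algebra

`F^ch` is the universal SUSY vertex algebra with a charged free fermion system: the linear
combinations of formal expressions in `|0⟩`, `φ_a`, `φ^ā` and the operations of a SUSY vertex
algebra, modulo those that vanish in every SUSY vertex algebra with such a system. -/

/-- Formal expressions in the vacuum, the generators and the operations. -/
inductive Expr (A : Type u) : Type u
  | vac : Expr A
  | phi (a : A) : Expr A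
  | psi (a : A) : Expr A
  | der (s : Expr A) : Expr A
  | mul (s t : Expr A) : Expr A
  | br0 (j : ℕ) (s t : Expr A) : Expr A
  | br1 (j : ℕ) (s t : Expr A) : Expr A

section Universal

variable {A : Type u}

/-- The value of an expression. -/
def Expr.eval {W : Type u} [AddCommGroup W] [Module ℂ W] [SUSYVertexAlgebra W] (φ ψ : A → W) :
    Expr A → W
  | .vac => SUSYVertexAlgebra.vac
  | .phi a => φ a
  | .psi a => ψ a
  | .der s => D (s.eval φ ψ)
  | .mul s t => SUSYVertexAlgebra.mul (s.eval φ ψ) (t.eval φ ψ)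
  | .br0 j s t => SUSYLieConformalAlgebra.br0 j (s.eval φ ψ) (t.eval φ ψ)
  | .br1 j s t => SUSYLieConformalAlgebra.br1 j (s.eval φ ψ) (t.eval φ ψ)

/-- The parity of an expression. -/
def Expr.parity (par : A → ZMod 2) : Expr A → ZMod 2
  | .vac => 0
  | .phi a => par a
  | .psi a => par a + 1
  | .der s => s.parity par + 1
  | .mul s t => s.parity par + t.parity par
  | .br0 _ s t => s.parity par + t.parity par + 1
  | .br1 _ s t => s.parity par + t.parity par

/-- The number of generators in an expression. -/
def Expr.len : Expr A → ℤ
  | .vac => 0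
  | .phi _ => 1
  | .psi _ => 1
  | .der s => s.len
  | .mul s t => s.len + t.len
  | .br0 _ s t => s.len + t.len
  | .br1 _ s t => s.len + t.len

/-- The weight of an expression. -/
def Expr.wt : Expr A → ℤ
  | .vac => 0
  | .phi _ => 1
  | .psi _ => 1
  | .der s => s.wt + 2
  | .mul s t => s.wt + t.wt
  | .br0 j s t => s.wt + t.wt - 2 - 4 * j
  | .br1 j s t => s.wt + t.wt - 2 - 4 * j - 2

variable (par : A → ZMod 2)

/-- A SUSY vertex algebra with a charged free fermion system. -/
structure Model where
  carrier : Type u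
  [grp : AddCommGroup carrier]
  [mod : Module ℂ carrier]
  [alg : SUSYVertexAlgebra carrier]
  φ : A → carrier
  ψ : A → carrier
  free : IsChargedFree par φ ψ

attribute [instance] Model.grp Model.mod Model.alg

variable {par}

theorem Expr.eval_mem (M : Model par) (s : Expr A) : s.eval M.φ M.ψ ∈ gr (s.parity par) := by
  induction s with
  | vac => exact vac_mem
  | phi a => exact M.free.φ_mem a
  | psi a => exact M.free.ψ_mem a
  | der s ih => exact D_mem ih
  | mul s t ihs iht => exact mul_mem ihs iht
  | br0 j s t ihs iht => exact br0_mem j ihs iht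
  | br1 j s t ihs iht => exact br1_mem j ihs iht

theorem Expr.eval_fil (M : Model par) (s : Expr A) :
    s.eval M.φ M.ψ ∈ fil M.φ M.ψ s.len s.wt := by
  have hvac : (SUSYVertexAlgebra.vac : M.carrier) ∈ fil M.φ M.ψ 0 0 := by
    simpa using (IsWord.nil (φ := M.φ) (ψ := M.ψ)).mem
  induction s with
  | vac => exact hvac
  | phi a =>
    have := letter_mul (IsLetter.fst (φ := M.φ) (ψ := M.ψ) 0 a) hvac
    simpa [mul_vac, Expr.eval, Expr.len, Expr.wt] using this
  | psi a =>
    have := letter_mul (IsLetter.snd (φ := M.φ) (ψ := M.ψ) 0 a) hvac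
    simpa [mul_vac, Expr.eval, Expr.len, Expr.wt] using this
  | der s ih => exact D_fil M.free ih
  | mul s t ihs iht => exact mul_fil M.free ihs iht
  | br0 j s t ihs iht => exact (BrIn.fil M.free ihs iht j).1
  | br1 j s t ihs iht => exact (BrIn.fil M.free ihs iht j).2

variable (par) in
/-- The relations: the linear combinations of expressions that vanish in every model. -/
noncomputable def relations : Submodule ℂ (Expr A →₀ ℂ) :=
  ⨅ M : Model par, LinearMap.ker (Finsupp.linearCombination ℂ (Expr.eval M.φ M.ψ))

variable (par) in
/-- The SUSY charged free fermion vertex algebra `F^ch` associated with a superspace that has a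
homogeneous basis `A` with parities `par`. -/
def Fch : Type u := (Expr A →₀ ℂ) ⧸ relations par

noncomputable instance : AddCommGroup (Fch par) :=
  inferInstanceAs (AddCommGroup ((Expr A →₀ ℂ) ⧸ relations par))

noncomputable instance : Module ℂ (Fch par) :=
  inferInstanceAs (Module ℂ ((Expr A →₀ ℂ) ⧸ relations par))

namespace Fch

/-- The class of a linear combination of expressions. -/
noncomputable def mk : (Expr A →₀ ℂ) →ₗ[ℂ] Fch par := (relations par).mkQ

/-- The class of an expression. -/
noncomputable def of (s : Expr A) : Fch par := mk (Finsupp.single s 1)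

/-- The evaluation of `F^ch` in a model. -/
noncomputable def lift (M : Model par) : Fch par →ₗ[ℂ] M.carrier :=
  (relations par).liftQ (Finsupp.linearCombination ℂ (Expr.eval M.φ M.ψ)) (iInf_le _ M)

theorem lift_mk (M : Model par) (x : Expr A →₀ ℂ) :
    lift M (mk x) = Finsupp.linearCombination ℂ (Expr.eval M.φ M.ψ) x :=
  (relations par).liftQ_apply _ _

theorem lift_of (M : Model par) (s : Expr A) : lift M (of s) = s.eval M.φ M.ψ := by
  rw [of, lift_mk]; simp

theorem mk_surjective : Function.Surjective (mk (par := par)) := (relations par).mkQ_surjective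

theorem ext_lift {x y : Fch par} (h : ∀ M : Model par, lift M x = lift M y) : x = y := by
  obtain ⟨x, rfl⟩ := mk_surjective x
  obtain ⟨y, rfl⟩ := mk_surjective y
  refine (Submodule.Quotient.eq _).2 ?_
  refine (Submodule.mem_iInf _).2 fun M => ?_
  rw [LinearMap.mem_ker, map_sub, sub_eq_zero, ← lift_mk, ← lift_mk, h]

theorem induction {P : Fch par → Prop} (zero : P 0) (add : ∀ x y, P x → P y → P (x + y))
    (smul : ∀ (z : ℂ) (s : Expr A), P (z • of s)) (x : Fch par) : P x := by
  obtain ⟨x, rfl⟩ := mk_surjective x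
  induction x using Finsupp.induction_linear with
  | zero => simpa using zero
  | add f g hf hg => rw [map_add]; exact add _ _ hf hg
  | single s z =>
    have := smul z s
    rwa [of, ← map_smul, Finsupp.smul_single, smul_eq_mul, mul_one] at this

/-- The linear operator given by an operation on expressions. -/
noncomputable def unary (op : Expr A → Expr A) (f : ∀ M : Model par, M.carrier →ₗ[ℂ] M.carrier)
    (h : ∀ M s, (op s).eval M.φ M.ψ = f M (s.eval M.φ M.ψ)) : Fch par →ₗ[ℂ] Fch par :=
  (relations par).liftQ (mk ∘ₗ Finsupp.lmapDomain ℂ ℂ op) (by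
    intro x hx
    refine ext_lift fun M => ?_
    have hM := (Submodule.mem_iInf _).1 hx M
    rw [LinearMap.mem_ker] at hM
    rw [LinearMap.comp_apply, lift_mk, map_zero]
    have : Finsupp.linearCombination ℂ (Expr.eval M.φ M.ψ) ∘ₗ Finsupp.lmapDomain ℂ ℂ op =
        f M ∘ₗ Finsupp.linearCombination ℂ (Expr.eval M.φ M.ψ) := by
      ext s; simp [h]
    have h2 := LinearMap.congr_fun this x
    simpa [hM] using h2)

theorem lift_unary {op : Expr A → Expr A} {f : ∀ M : Model par, M.carrier →ₗ[ℂ] M.carrier}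
    (h : ∀ M s, (op s).eval M.φ M.ψ = f M (s.eval M.φ M.ψ)) (M : Model par) (x : Fch par) :
    lift M (unary op f h x) = f M (lift M x) := by
  induction x using induction with
  | zero => simp
  | add x y hx hy => simp [hx, hy]
  | smul z s =>
    have : unary op f h (of s) = of (op s) := by
      refine ((relations par).liftQ_apply _ _).trans ?_
      simp [of]
    rw [map_smul, map_smul, map_smul, map_smul, this, lift_of, lift_of, h]

/-- The bilinear operation given by a binary operation on expressions. -/
noncomputable def binaryAux (op : Expr A → Expr A → Expr A)
    (f : ∀ M : Model par, M.carrier →ₗ[ℂ] M.carrier →ₗ[ℂ] M.carrier)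
    (h : ∀ M s t, (op s t).eval M.φ M.ψ = f M (s.eval M.φ M.ψ) (t.eval M.φ M.ψ)) :
    (Expr A →₀ ℂ) →ₗ[ℂ] Fch par →ₗ[ℂ] Fch par :=
  Finsupp.linearCombination ℂ fun s => unary (op s) (fun M => f M (s.eval M.φ M.ψ))
    (fun M t => h M s t)

theorem lift_binaryAux {op : Expr A → Expr A → Expr A}
    {f : ∀ M : Model par, M.carrier →ₗ[ℂ] M.carrier →ₗ[ℂ] M.carrier}
    (h : ∀ M s t, (op s t).eval M.φ M.ψ = f M (s.eval M.φ M.ψ) (t.eval M.φ M.ψ))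
    (M : Model par) (x : Expr A →₀ ℂ) (y : Fch par) :
    lift M (binaryAux op f h x y) = f M (lift M (mk x)) (lift M y) := by
  induction x using Finsupp.induction_linear with
  | zero => simp
  | add x x' hx hx' => simp [hx, hx']
  | single s z => simp [binaryAux, lift_unary, lift_mk]

/-- The bilinear operation given by a binary operation on expressions. -/
noncomputable def binary (op : Expr A → Expr A → Expr A)
    (f : ∀ M : Model par, M.carrier →ₗ[ℂ] M.carrier →ₗ[ℂ] M.carrier)
    (h : ∀ M s t, (op s t).eval M.φ M.ψ = f M (s.eval M.φ M.ψ) (t.eval M.φ M.ψ)) :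
    Fch par →ₗ[ℂ] Fch par →ₗ[ℂ] Fch par :=
  (relations par).liftQ (binaryAux op f h) (by
    intro x hx
    rw [LinearMap.mem_ker]
    ext y
    refine ext_lift fun M => ?_
    have hM := (Submodule.mem_iInf _).1 hx M
    rw [LinearMap.mem_ker] at hM
    rw [lift_binaryAux, lift_mk, hM]
    simp)

theorem lift_binary {op : Expr A → Expr A → Expr A}
    {f : ∀ M : Model par, M.carrier →ₗ[ℂ] M.carrier →ₗ[ℂ] M.carrier}
    (h : ∀ M s t, (op s t).eval M.φ M.ψ = f M (s.eval M.φ M.ψ) (t.eval M.φ M.ψ))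
    (M : Model par) (x y : Fch par) :
    lift M (binary op f h x y) = f M (lift M x) (lift M y) := by
  obtain ⟨x, rfl⟩ := mk_surjective x
  have : binary op f h (mk x) = binaryAux op f h x := (relations par).liftQ_apply _ _
  rw [this, lift_binaryAux]

variable (par) in
/-- `D` on `F^ch`. -/
noncomputable def der : Fch par →ₗ[ℂ] Fch par :=
  unary Expr.der (fun _ => D) fun _ _ => rfl

variable (par) in
/-- The product of `F^ch`. -/
noncomputable def prod : Fch par →ₗ[ℂ] Fch par →ₗ[ℂ] Fch par :=
  binary Expr.mul (fun _ => mul) fun _ _ _ => rfl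

variable (par) in
/-- The products `(j|0)` of `F^ch`. -/
noncomputable def bracket0 (j : ℕ) : Fch par →ₗ[ℂ] Fch par →ₗ[ℂ] Fch par :=
  binary (Expr.br0 j) (fun _ => br0 j) fun _ _ _ => rfl

variable (par) in
/-- The products `(j|1)` of `F^ch`. -/
noncomputable def bracket1 (j : ℕ) : Fch par →ₗ[ℂ] Fch par →ₗ[ℂ] Fch par :=
  binary (Expr.br1 j) (fun _ => br1 j) fun _ _ _ => rfl

variable (par) in
/-- The homogeneous components of `F^ch`. -/
noncomputable def grading (p : ZMod 2) : Submodule ℂ (Fch par) :=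
  ⨅ M : Model par, (gr p).comap (lift M)

theorem mem_grading {p : ZMod 2} {x : Fch par} :
    x ∈ grading par p ↔ ∀ M : Model par, lift M x ∈ gr p := by
  simp [grading, Submodule.mem_iInf]

theorem lift_der (M : Model par) (x : Fch par) : lift M (der par x) = D (lift M x) :=
  lift_unary _ M x

theorem lift_der_pow (M : Model par) (e : ℕ) (x : Fch par) :
    lift M ((der par ^ e : Module.End ℂ (Fch par)) x) = (D ^ e) (lift M x) := by
  induction e with
  | zero => simp
  | succ e ih =>
    rw [pow_succ', pow_succ', Module.End.mul_apply, Module.End.mul_apply, lift_der, ih]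

theorem lift_prod (M : Model par) (x y : Fch par) :
    lift M (prod par x y) = mul (lift M x) (lift M y) := lift_binary _ M x y

theorem lift_bracket0 (M : Model par) (j : ℕ) (x y : Fch par) :
    lift M (bracket0 par j x y) = br0 j (lift M x) (lift M y) := lift_binary _ M x y

theorem lift_bracket1 (M : Model par) (j : ℕ) (x y : Fch par) :
    lift M (bracket1 par j x y) = br1 j (lift M x) (lift M y) := lift_binary _ M x y

theorem grading_isCompl : IsCompl (grading par 0) (grading par 1) := by
  constructor
  · rw [Submodule.disjoint_def]
    intro x h0 h1
    refine ext_lift fun M => ?_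
    rw [map_zero]
    exact Submodule.disjoint_def.1 (gr_isCompl (V := M.carrier)).disjoint _
      (mem_grading.1 h0 M) (mem_grading.1 h1 M)
  · rw [codisjoint_iff, eq_top_iff]
    intro x _
    induction x using induction with
    | zero => exact Submodule.zero_mem _
    | add x y hx hy => exact Submodule.add_mem _ (hx trivial) (hy trivial)
    | smul z s =>
      refine Submodule.smul_mem _ _ ?_
      have hs : of s ∈ grading par (s.parity par) :=
        mem_grading.2 fun M => by rw [lift_of]; exact s.eval_mem M
      have h01 : ∀ p : ZMod 2, p = 0 ∨ p = 1 := by decide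
      rcases h01 (s.parity par) with h | h
      · rw [h] at hs; exact Submodule.mem_sup_left hs
      · rw [h] at hs; exact Submodule.mem_sup_right hs

theorem bracket_finite (x y : Fch par) :
    ∃ N : ℕ, ∀ j, N ≤ j → bracket0 par j x y = 0 ∧ bracket1 par j x y = 0 := by
  induction x using induction with
  | zero => exact ⟨0, fun j _ => by simp⟩
  | add x x' hx hx' =>
    obtain ⟨N, hN⟩ := hx
    obtain ⟨N', hN'⟩ := hx'
    refine ⟨max N N', fun j hj => ?_⟩
    have h1 := hN j (le_trans (le_max_left _ _) hj)
    have h2 := hN' j (le_trans (le_max_right _ _) hj)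
    simp [h1, h2]
  | smul z s =>
    induction y using induction with
    | zero => exact ⟨0, fun j _ => by simp⟩
    | add y y' hy hy' =>
      obtain ⟨N, hN⟩ := hy
      obtain ⟨N', hN'⟩ := hy'
      refine ⟨max N N', fun j hj => ?_⟩
      have h1 := hN j (le_trans (le_max_left _ _) hj)
      have h2 := hN' j (le_trans (le_max_right _ _) hj)
      rw [map_add, map_add, h1.1, h1.2, h2.1, h2.2]
      simp
    | smul z' t =>
      refine ⟨(s.wt + t.wt - 2).toNat + 1, fun j hj => ?_⟩
      have key : ∀ M : Model par, br0 j (s.eval M.φ M.ψ) (t.eval M.φ M.ψ) = 0 ∧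
          br1 j (s.eval M.φ M.ψ) (t.eval M.φ M.ψ) = 0 := fun M =>
        (BrIn.fil M.free (s.eval_fil M) (t.eval_fil M)).bound j hj
      constructor
      · refine ext_lift fun M => ?_
        rw [lift_bracket0]; simp [lift_of, (key M).1]
      · refine ext_lift fun M => ?_
        rw [lift_bracket1]; simp [lift_of, (key M).2]

theorem lift_vanish {a b : Fch par} {N : ℕ}
    (h : ∀ j, N ≤ j → bracket0 par j a b = 0 ∧ bracket1 par j a b = 0) (M : Model par) :
    ∀ j, N ≤ j → br0 j (lift M a) (lift M b) = 0 ∧ br1 j (lift M a) (lift M b) = 0 := by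
  intro j hj
  rw [← lift_bracket0, ← lift_bracket1, (h j hj).1, (h j hj).2]
  simp

theorem lift_vanish1 {a b : Fch par} {N : ℕ}
    (h : ∀ j, N ≤ j → bracket1 par j a b = 0) (M : Model par) :
    ∀ j, N ≤ j → br1 j (lift M a) (lift M b) = 0 := by
  intro j hj
  rw [← lift_bracket1, h j hj, map_zero]

noncomputable instance : SUSYLieConformalAlgebra (Fch par) where
  gr := grading par
  D := der par
  br0 := bracket0 par
  br1 := bracket1 par
  gr_isCompl := grading_isCompl
  D_mem h := mem_grading.2 fun M => by
    rw [lift_der]; exact D_mem (mem_grading.1 h M)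
  br0_mem j ha hb := mem_grading.2 fun M => by
    rw [lift_bracket0]; exact br0_mem j (mem_grading.1 ha M) (mem_grading.1 hb M)
  br1_mem j ha hb := mem_grading.2 fun M => by
    rw [lift_bracket1]; exact br1_mem j (mem_grading.1 ha M) (mem_grading.1 hb M)
  br_finite := bracket_finite
  br0_D_left_zero a b := ext_lift fun M => by
    simp only [lift_bracket0, lift_der, map_zero]; exact br0_D_left_zero _ _
  br0_D_left_succ j a b := ext_lift fun M => by
    simp only [lift_bracket0, lift_bracket1, lift_der, map_smul]; exact br0_D_left_succ j _ _
  br1_D_left j a b := ext_lift fun M => by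
    simp only [lift_bracket0, lift_bracket1, lift_der]; exact br1_D_left j _ _
  br0_D_right j _ _ b ha := ext_lift fun M => by
    simp only [lift_bracket0, lift_bracket1, lift_der, map_smul, map_add]
    exact br0_D_right j _ (mem_grading.1 ha M)
  br1_D_right j _ _ b ha := ext_lift fun M => by
    simp only [lift_bracket0, lift_bracket1, lift_der, map_smul, map_sub]
    exact br1_D_right j _ (mem_grading.1 ha M)
  skew0 m N _ _ _ _ ha hb h := ext_lift fun M => by
    simp only [lift_bracket0, lift_bracket1, lift_der, lift_der_pow, map_smul, map_sub, map_sum]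
    simpa only [map_sub] using
      skew0 m N (mem_grading.1 ha M) (mem_grading.1 hb M) (lift_vanish h M)
  skew1 m N _ _ _ _ ha hb h := ext_lift fun M => by
    simp only [lift_bracket1, lift_der_pow, map_smul, map_sum]
    exact skew1 m N (mem_grading.1 ha M) (mem_grading.1 hb M) (lift_vanish h M)
  jacobi00 m n _ _ _ _ c ha hb := ext_lift fun M => by
    simp only [lift_bracket0, lift_bracket1, map_smul, map_add, map_sum]
    exact jacobi00 m n _ (mem_grading.1 ha M) (mem_grading.1 hb M)
  jacobi10 m n _ _ _ _ c ha hb := ext_lift fun M => by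
    simp only [lift_bracket0, lift_bracket1, map_smul, map_add, map_sub, map_sum]
    exact jacobi10 m n _ (mem_grading.1 ha M) (mem_grading.1 hb M)
  jacobi01 m n _ _ _ _ c ha hb := ext_lift fun M => by
    simp only [lift_bracket0, lift_bracket1, map_smul, map_add, map_sum]
    exact jacobi01 m n _ (mem_grading.1 ha M) (mem_grading.1 hb M)
  jacobi11 m n _ _ _ _ c ha hb := ext_lift fun M => by
    simp only [lift_bracket1, map_smul, map_add, map_sum]
    exact jacobi11 m n _ (mem_grading.1 ha M) (mem_grading.1 hb M)

noncomputable instance : SUSYVertexAlgebra (Fch par) where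
  vac := of Expr.vac
  mul := prod par
  vac_mem := mem_grading.2 fun M => by rw [lift_of]; exact Expr.vac.eval_mem M
  mul_mem ha hb := mem_grading.2 fun M => by
    rw [lift_prod]; exact mul_mem (mem_grading.1 ha M) (mem_grading.1 hb M)
  vac_mul a := ext_lift fun M => by
    rw [lift_prod, lift_of]; exact vac_mul _
  mul_vac a := ext_lift fun M => by
    rw [lift_prod, lift_of]; exact mul_vac _
  D_mul b ha := ext_lift fun M => by
    have h := D_mul (lift M b) (mem_grading.1 ha M)
    have hD : ∀ x : Fch par, lift M (D x) = D (lift M x) := lift_der M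
    simp only [hD, lift_prod, map_smul, map_add]
    exact h
  quasi_comm N _ _ a b ha hb h := ext_lift fun M => by
    have hD : ∀ (e : ℕ) (x : Fch par), lift M ((D ^ e) x) = (D ^ e) (lift M x) :=
      lift_der_pow M
    have hb1 : ∀ (j : ℕ) (x y : Fch par), lift M (br1 j x y) = br1 j (lift M x) (lift M y) :=
      lift_bracket1 M
    simp only [hD, hb1, lift_prod, map_smul, map_sub, map_sum]
    exact quasi_comm N (mem_grading.1 ha M) (mem_grading.1 hb M) (lift_vanish1 h M)
  quasi_assoc N _ _ a b c ha hb h h' := ext_lift fun M => by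
    have hD : ∀ (e : ℕ) (x : Fch par), lift M ((D ^ e) x) = (D ^ e) (lift M x) :=
      lift_der_pow M
    have hb1 : ∀ (j : ℕ) (x y : Fch par), lift M (br1 j x y) = br1 j (lift M x) (lift M y) :=
      lift_bracket1 M
    simp only [hD, hb1, lift_prod, map_smul, map_sub, map_add, map_sum]
    exact quasi_assoc N _ (mem_grading.1 ha M) (mem_grading.1 hb M) (lift_vanish1 h M)
      (lift_vanish1 h' M)
  wick0 m _ _ _ _ c ha hb := ext_lift fun M => by
    have hb0 : ∀ (j : ℕ) (x y : Fch par), lift M (br0 j x y) = br0 j (lift M x) (lift M y) :=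
      lift_bracket0 M
    have hb1 : ∀ (j : ℕ) (x y : Fch par), lift M (br1 j x y) = br1 j (lift M x) (lift M y) :=
      lift_bracket1 M
    simp only [hb0, hb1, lift_prod, map_smul, map_add, map_sum]
    exact wick0 m _ (mem_grading.1 ha M) (mem_grading.1 hb M)
  wick1 m _ _ _ _ c ha hb := ext_lift fun M => by
    have hb1 : ∀ (j : ℕ) (x y : Fch par), lift M (br1 j x y) = br1 j (lift M x) (lift M y) :=
      lift_bracket1 M
    simp only [hb1, lift_prod, map_smul, map_add, map_sum]
    exact wick1 m _ (mem_grading.1 ha M) (mem_grading.1 hb M)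

variable (par) in
/-- The generator `φ_a` of `F^ch`. -/
noncomputable def phi (a : A) : Fch par := of (Expr.phi a)

variable (par) in
/-- The generator `φ^ā` of `F^ch`. -/
noncomputable def psi (a : A) : Fch par := of (Expr.psi a)

theorem isHom_lift (M : Model par) : IsHom (lift M) where
  map_gr h := mem_grading.1 h M
  map_vac := lift_of M _
  map_D := lift_der M
  map_mul := lift_prod M
  map_br0 := lift_bracket0 M
  map_br1 := lift_bracket1 M

/-- The generators of `F^ch` form a charged free fermion system. -/
theorem isChargedFree : IsChargedFree par (phi par) (psi par) where
  φ_mem a := mem_grading.2 fun M => by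
    rw [phi, lift_of]; exact M.free.φ_mem a
  ψ_mem a := mem_grading.2 fun M => by
    rw [psi, lift_of]; exact M.free.ψ_mem a
  φψ_same a j := ext_lift fun M => by
    rw [(isHom_lift M).map_br0, phi, psi, lift_of, lift_of]
    refine (M.free.φψ_same a j).trans ?_
    split_ifs
    · exact (isHom_lift M).map_vac.symm
    · exact (map_zero _).symm
  φψ_ne a b j hab := ext_lift fun M => by
    rw [(isHom_lift M).map_br0, phi, psi, lift_of, lift_of, map_zero]
    exact M.free.φψ_ne a b j hab
  φψ_br1 a b j := ext_lift fun M => by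
    rw [(isHom_lift M).map_br1, phi, psi, lift_of, lift_of, map_zero]
    exact M.free.φψ_br1 a b j
  φφ a b j := ⟨ext_lift fun M => by
      rw [(isHom_lift M).map_br0, phi, phi, lift_of, lift_of, map_zero]
      exact (M.free.φφ a b j).1, ext_lift fun M => by
      rw [(isHom_lift M).map_br1, phi, phi, lift_of, lift_of, map_zero]
      exact (M.free.φφ a b j).2⟩
  ψψ a b j := ⟨ext_lift fun M => by
      rw [(isHom_lift M).map_br0, psi, psi, lift_of, lift_of, map_zero]
      exact (M.free.ψψ a b j).1, ext_lift fun M => by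
      rw [(isHom_lift M).map_br1, psi, psi, lift_of, lift_of, map_zero]
      exact (M.free.ψψ a b j).2⟩

theorem apply_of {W : Type u} [AddCommGroup W] [Module ℂ W] [SUSYVertexAlgebra W]
    {f : Fch par →ₗ[ℂ] W} (hf : IsHom f) (s : Expr A) :
    f (of s) = s.eval (fun a => f (phi par a)) (fun a => f (psi par a)) := by
  have hder : ∀ s : Expr A, of (par := par) (.der s) = D (of s) := fun s =>
    ext_lift fun M => by rw [(isHom_lift M).map_D, lift_of, lift_of]; rfl
  have hmul : ∀ s t : Expr A, of (par := par) (.mul s t) = mul (of s) (of t) := fun s t =>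
    ext_lift fun M => by rw [(isHom_lift M).map_mul, lift_of, lift_of, lift_of]; rfl
  have hbr0 : ∀ j, ∀ s t : Expr A, of (par := par) (.br0 j s t) = br0 j (of s) (of t) :=
    fun j s t => ext_lift fun M => by
      rw [(isHom_lift M).map_br0, lift_of, lift_of, lift_of]; rfl
  have hbr1 : ∀ j, ∀ s t : Expr A, of (par := par) (.br1 j s t) = br1 j (of s) (of t) :=
    fun j s t => ext_lift fun M => by
      rw [(isHom_lift M).map_br1, lift_of, lift_of, lift_of]; rfl
  induction s with
  | vac => exact hf.map_vac
  | phi a => rfl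
  | psi a => rfl
  | der s ih => rw [hder, hf.map_D, ih]; rfl
  | mul s t ihs iht => rw [hmul, hf.map_mul, ihs, iht]; rfl
  | br0 j s t ihs iht => rw [hbr0, hf.map_br0, ihs, iht]; rfl
  | br1 j s t ihs iht => rw [hbr1, hf.map_br1, ihs, iht]; rfl

/-- The universal property of the enveloping SUSY vertex algebra `F^ch`: a charged free fermion
system in a SUSY vertex algebra extends uniquely to a homomorphism from `F^ch`. -/
theorem existsUnique_hom {W : Type u} [AddCommGroup W] [Module ℂ W] [SUSYVertexAlgebra W]
    {φ ψ : A → W} (H : IsChargedFree par φ ψ) :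
    ∃! f : Fch par →ₗ[ℂ] W, IsHom f ∧ (∀ a, f (phi par a) = φ a) ∧ ∀ a, f (psi par a) = ψ a := by
  let M : Model par := { carrier := W, φ := φ, ψ := ψ, free := H }
  refine ⟨lift M, ⟨isHom_lift M, fun a => lift_of M _, fun a => lift_of M _⟩, ?_⟩
  rintro f ⟨hf, h1, h2⟩
  ext x
  induction x using induction with
  | zero => simp
  | add x y hx hy => simp [hx, hy]
  | smul z s =>
    rw [map_smul, map_smul, apply_of hf, lift_of]
    simp only [h1, h2]
    rfl

variable (par) in
/-- The standard vector `T^ch_st`. -/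
noncomputable def Tst [Fintype A] : Fch par :=
  (∑ a with par a = 0, (mul (del (phi par a)) (psi par a) +
    mul (D (phi par a)) (D (psi par a)))) +
  (∑ a with par a = 1, (mul (phi par a) (del (psi par a)) +
    mul (D (phi par a)) (D (psi par a))))

variable (par) in
/-- The shifted vector `T^ch_sh` with parameters `t`. -/
noncomputable def Tsh [Fintype A] (t : A → ℂ) : Fch par :=
  (∑ a with par a = 0, ((t a + 1) • mul (del (phi par a)) (psi par a) +
    t a • mul (phi par a) (del (psi par a)) + mul (D (phi par a)) (D (psi par a)))) +
  (∑ a with par a = 1, (t a • mul (del (phi par a)) (psi par a) +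
    (t a + 1) • mul (phi par a) (del (psi par a)) + mul (D (phi par a)) (D (psi par a))))

end Fch

end Universal

end SUSYVertexAlgebra

/-!
Exchanging `φ_a` and `φ^ā` for the odd `a` turns the generators into pairs `x_a` even, `y_a` odd
with `[x_a _Λ y_b] = [y_b _Λ x_a] = δ_ab`. The products that occur in `T` have commuting factors,
because the integral in quasi-commutativity only involves the `χ`-part of the brackets, which
vanishes for them (`summand_comm`); hence `T = ∑_a T_a`,
`T_a = (t_a + 1) ∂x_a y_a + t_a x_a ∂y_a + Dx_a Dy_a`, with no distinction of parities
(`Fch.Tsh_eq_superconformal`).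

The Wick formula gives `[x_a _Λ T]` and `[y_a _Λ T]`, and skew-symmetry turns these into
`[T _Λ x_a] = (2∂ - t_a λ + χD) x_a` and `[T _Λ y_a] = (2∂ + (t_a + 1) λ + χD) y_a`
(`isPrimary_evenGen`, `isPrimary_oddGen`). By the Wick formula for `λ = 0`, `T_(0|0)` and
`T_(0|1)` are derivations of the product, just as `2∂` and `D`, so they agree with these on all
words in the derivatives of the generators; `T_(1|0)` is then also a derivation of the product and
satisfies `[T_(1|0), D] = D`, so every word is an eigenvector. Since `F^ch` is spanned by the words
(`Fch.span_words`), this settles the modes and diagonalizability (`Fch.isConformal_span`).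

In `[T _Λ T]` the terms of degree `0` in `λ` are now known, and the coefficient `3` of `λ` is the
eigenvalue of `T_(1|0)` on each term of `T_a`. The Wick formula for `[T _Λ T_a]` shows that the
only other coefficient is the one of `χλ²/2`, to which `T_a` contributes `4 t_a + 2`
(`br_summand`).
-/

namespace SUSYVertexAlgebra

open SUSYLieConformalAlgebra

/-! ### Signs and parities -/

theorem sgn_zero : sgn 0 = 1 := by simp [sgn]

theorem sgn_one : sgn 1 = -1 := by
  have : (1 : ZMod 2).val = 1 := rfl
  simp [sgn, this]

theorem zmod_two_eq_zero_or_one (p : ZMod 2) : p = 0 ∨ p = 1 := by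
  revert p; decide

theorem zmod_two_one_add_one : (1 + 1 : ZMod 2) = 0 := rfl

/-! ### Contractions and primary vectors -/

section Brackets

variable {W : Type u} [AddCommGroup W] [Module ℂ W] [SUSYVertexAlgebra W]

theorem del_apply (b : W) : del b = D (D b) := rfl

theorem D_mem_odd {b : W} (hb : b ∈ gr 0) : D b ∈ gr (1 : ZMod 2) := by
  simpa using D_mem hb

theorem D_mem_even {b : W} (hb : b ∈ gr 1) : D b ∈ gr (0 : ZMod 2) := by
  simpa only [zmod_two_one_add_one] using D_mem hb

/-- The bracket `[u _Λ v]` is the constant `κ`. -/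
def IsContraction (u v : W) (κ : ℂ) : Prop :=
  ∀ j, br0 j u v = (if j = 0 then κ • vac else 0) ∧ br1 j u v = 0

/-- `b` is a primary vector of conformal weight `w / 2` for `T`:
`[T _Λ b] = (2∂ + wλ + χD) b`. -/
structure IsPrimary (T b : W) (w : ℂ) : Prop where
  br0_eq : ∀ j, br0 j T b = if j = 0 then (2 : ℂ) • D (D b) else if j = 1 then w • b else 0
  br1_eq : ∀ j, br1 j T b = if j = 0 then D b else 0

theorem IsContraction.symm {u v : W} {κ : ℂ} {p q : ZMod 2} (hu : u ∈ gr p) (hv : v ∈ gr q)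
    (hκ : sgn (p * q) * κ = κ) (h : IsContraction u v κ) : IsContraction v u κ := by
  intro j
  have hN : ∀ j, 1 ≤ j → br0 j u v = 0 ∧ br1 j u v = 0 := fun j hj => by
    rw [(h j).1, (h j).2, if_neg (by omega)]; exact ⟨rfl, rfl⟩
  rw [skew0 j 1 hu hv hN, skew1 j 1 hu hv hN]
  rcases j with _ | j <;> simp [(h _).1, (h _).2, smul_smul, hκ]

section Contractions

variable {u v : W} {κ : ℂ}

theorem IsContraction.br_D_even (hu : u ∈ gr 0) (h : IsContraction u v κ) (j : ℕ) :
    br0 j u (D v) = 0 ∧ br1 j u (D v) = if j = 0 then -κ • vac else 0 := by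
  rw [br0_D_right j v hu, br1_D_right j v hu]
  rcases j with _ | j <;> simp [(h _).1, (h _).2, sgn_one, D_vac]

theorem IsContraction.br_D_odd (hu : u ∈ gr 1) (h : IsContraction u v κ) (j : ℕ) :
    br0 j u (D v) = 0 ∧ br1 j u (D v) = if j = 0 then κ • vac else 0 := by
  rw [br0_D_right j v hu, br1_D_right j v hu, zmod_two_one_add_one]
  rcases j with _ | j <;> simp [(h _).1, (h _).2, sgn_zero, D_vac]

theorem IsContraction.br_DD_even (hu : u ∈ gr 0) (h : IsContraction u v κ) (j : ℕ) :
    br0 j u (D (D v)) = (if j = 1 then κ • vac else 0) ∧ br1 j u (D (D v)) = 0 := by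
  rw [br0_D_right j _ hu, br1_D_right j _ hu, (h.br_D_even hu _).1, (h.br_D_even hu _).2,
    (h.br_D_even hu _).2]
  rcases j with _ | _ | j <;> simp [sgn_one, D_vac]

theorem IsContraction.br_DD_odd (hu : u ∈ gr 1) (h : IsContraction u v κ) (j : ℕ) :
    br0 j u (D (D v)) = (if j = 1 then κ • vac else 0) ∧ br1 j u (D (D v)) = 0 := by
  rw [br0_D_right j _ hu, br1_D_right j _ hu, (h.br_D_odd hu _).1, (h.br_D_odd hu _).2,
    (h.br_D_odd hu _).2, zmod_two_one_add_one]
  rcases j with _ | _ | j <;> simp [sgn_zero, D_vac]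

end Contractions

/-- The summand of the superconformal vector that belongs to an even vector `x` and an odd
vector `y`. -/
noncomputable def summand (s : ℂ) (x y : W) : W :=
  (s + 1) • mul (D (D x)) y + s • mul x (D (D y)) + mul (D x) (D y)

theorem summand_mem (s : ℂ) {x y : W} (hx : x ∈ gr 0) (hy : y ∈ gr 1) :
    summand s x y ∈ gr (1 : ZMod 2) := by
  have h1 := mul_mem (D_mem_even (D_mem_odd hx)) hy
  have h2 := mul_mem hx (D_mem_odd (D_mem_even hy))
  have h3 := mul_mem (D_mem_odd hx) (D_mem_even hy)
  rw [zero_add] at h1 h2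
  rw [add_zero] at h3
  exact Submodule.add_mem _ (Submodule.add_mem _ (Submodule.smul_mem _ _ h1)
    (Submodule.smul_mem _ _ h2)) h3

theorem br_even_summand (s κ : ℂ) {u x y : W} (hu : u ∈ gr 0) (hx : x ∈ gr 0)
    (hux : IsContraction u x 0) (huy : IsContraction u y κ) (j : ℕ) :
    br0 j u (summand s x y) =
      (if j = 0 then (κ * (s + 1)) • D (D x) else if j = 1 then (κ * s) • x else 0) ∧
    br1 j u (summand s x y) = if j = 0 then -κ • D x else 0 := by
  have hDx := D_mem_odd hx
  have hDDx := D_mem_even hDx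
  simp only [summand, map_add, map_smul, wick0 j _ hu hDDx, wick0 j _ hu hx, wick0 j _ hu hDx,
    wick1 j _ hu hDDx, wick1 j _ hu hx, wick1 j _ hu hDx]
  simp only [(hux _).1, (hux _).2, (huy _).1, (huy _).2, (hux.br_D_even hu _).1,
    (hux.br_D_even hu _).2, (huy.br_D_even hu _).1, (huy.br_D_even hu _).2,
    (hux.br_DD_even hu _).1, (hux.br_DD_even hu _).2, (huy.br_DD_even hu _).1,
    (huy.br_DD_even hu _).2]
  rcases j with _ | _ | j <;> simp [sgn_zero, mul_vac, smul_smul, mul_comm]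

theorem br_odd_summand (s κ : ℂ) {u x y : W} (hu : u ∈ gr 1) (hx : x ∈ gr 0)
    (hux : IsContraction u x κ) (huy : IsContraction u y 0) (j : ℕ) :
    br0 j u (summand s x y) =
      (if j = 0 then (κ * s) • D (D y) else if j = 1 then (κ * (s + 1)) • y else 0) ∧
    br1 j u (summand s x y) = if j = 0 then κ • D y else 0 := by
  have hDx := D_mem_odd hx
  have hDDx := D_mem_even hDx
  have hvac : ∀ (k : ℕ) (p : Prop) [Decidable p] (c : W),
      br1 k (if p then κ • (vac : W) else 0) c = 0 := fun k p _ c => by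
    split_ifs <;> simp [br1_vac_left]
  simp only [summand, map_add, map_smul, wick0 j _ hu hDDx, wick0 j _ hu hx, wick0 j _ hu hDx,
    wick1 j _ hu hDDx, wick1 j _ hu hx, wick1 j _ hu hDx]
  simp only [(hux _).1, (hux _).2, (huy _).1, (huy _).2, (hux.br_D_odd hu _).1,
    (hux.br_D_odd hu _).2, (huy.br_D_odd hu _).1, (huy.br_D_odd hu _).2,
    (hux.br_DD_odd hu _).1, (hux.br_DD_odd hu _).2, (huy.br_DD_odd hu _).1,
    (huy.br_DD_odd hu _).2]
  rcases j with _ | _ | j <;>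
    simp [sgn_zero, vac_mul, smul_smul, mul_comm, hvac]

/-- Skew-symmetry turns the bracket of an even generator with `T` into primarity. -/
theorem isPrimary_of_even (s : ℂ) {T x : W} (hT : T ∈ gr 1) (hx : x ∈ gr 0)
    (h : ∀ j, br0 j x T =
        (if j = 0 then (s + 1) • D (D x) else if j = 1 then s • x else 0) ∧
      br1 j x T = if j = 0 then -D x else 0) :
    IsPrimary T x (-s) := by
  have hN : ∀ j, 2 ≤ j → br0 j x T = 0 ∧ br1 j x T = 0 := fun j hj => by
    rw [(h j).1, (h j).2]
    simp [show j ≠ 0 by omega, show j ≠ 1 by omega]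
  constructor <;> intro j
  · rw [skew0 j 2 hx hT hN]
    rcases j with _ | _ | j
    · simp [Finset.sum_range_succ, (h _).1, (h _).2, sgn_zero, pow_succ]
      module
    · simp [Finset.sum_range_succ, (h _).1, (h _).2, sgn_zero]
    · simp [Finset.sum_range_succ, (h _).1, (h _).2, sgn_zero]
  · rw [skew1 j 2 hx hT hN]
    rcases j with _ | _ | j <;>
      simp [Finset.sum_range_succ, (h _).2, sgn_zero]

theorem isPrimary_of_odd (s : ℂ) {T y : W} (hT : T ∈ gr 1) (hy : y ∈ gr 1)
    (h : ∀ j, br0 j y T =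
        (if j = 0 then s • D (D y) else if j = 1 then (s + 1) • y else 0) ∧
      br1 j y T = if j = 0 then D y else 0) :
    IsPrimary T y (s + 1) := by
  have hN : ∀ j, 2 ≤ j → br0 j y T = 0 ∧ br1 j y T = 0 := fun j hj => by
    rw [(h j).1, (h j).2]
    simp [show j ≠ 0 by omega, show j ≠ 1 by omega]
  constructor <;> intro j
  · rw [skew0 j 2 hy hT hN]
    rcases j with _ | _ | j
    · simp [Finset.sum_range_succ, (h _).1, (h _).2, sgn_one, pow_succ]
      module
    · simp [Finset.sum_range_succ, (h _).1, (h _).2, sgn_one]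
    · simp [Finset.sum_range_succ, (h _).1, (h _).2, sgn_one]
  · rw [skew1 j 2 hy hT hN]
    rcases j with _ | _ | j <;>
      simp [Finset.sum_range_succ, (h _).2, sgn_one]

end Brackets

/-! ### The action of `T` on derivatives and products of primary vectors -/

section Primary

variable {W : Type u} [AddCommGroup W] [Module ℂ W] [SUSYVertexAlgebra W] {T b : W} {w : ℂ}

/-- `[T _Λ Db] = (D + χ) [T _Λ b]`: derivatives of primary vectors are no longer primary. -/
theorem IsPrimary.br_D (hT : T ∈ gr 1) (h : IsPrimary T b w) (j : ℕ) :
    br0 j T (D b) =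
      (if j = 0 then (2 : ℂ) • D (D (D b)) else if j = 1 then (w + 1) • D b else 0) ∧
    br1 j T (D b) = if j = 0 then D (D b) else if j = 1 then w • b else 0 := by
  rw [br0_D_right j b hT, br1_D_right j b hT, h.br0_eq, h.br1_eq, h.br1_eq,
    zmod_two_one_add_one]
  rcases j with _ | _ | j
  · simp [sgn_zero]; module
  · simp [sgn_zero]; module
  · simp [sgn_zero]

theorem IsPrimary.br_DD (hT : T ∈ gr 1) (h : IsPrimary T b w) (j : ℕ) :
    br0 j T (D (D b)) =
      (if j = 0 then (2 : ℂ) • D (D (D (D b))) else if j = 1 then (w + 2) • D (D b)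
        else if j = 2 then (2 * w) • b else 0) ∧
    br1 j T (D (D b)) = if j = 0 then D (D (D b)) else if j = 1 then D b else 0 := by
  rw [br0_D_right j _ hT, br1_D_right j _ hT, (h.br_D hT _).1, (h.br_D hT _).2,
    (h.br_D hT _).2, zmod_two_one_add_one]
  rcases j with _ | _ | _ | j
  · simp [sgn_zero]; module
  · simp [sgn_zero]; constructor <;> module
  · simp [sgn_zero, smul_smul]
  · simp [sgn_zero]

/-- For primary `x`, `y` of weights adding up to `1 / 2`, the only coefficient of
`[T _Λ summand s x y]` beyond those of `1`, `χ` and `λ` is `4s + 2` at `χλ² / 2`: the multiples of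
`Dx y`, `x Dy` and `x y` cancel, and the three products in `summand` contribute the central terms
`s + 1`, `s` and `2s + 1`. -/
theorem br_summand (s : ℂ) {x y : W} (hT : T ∈ gr 1) (hx : x ∈ gr 0)
    (hxy : IsContraction x y 1) (hTx : IsPrimary T x (-s)) (hTy : IsPrimary T y (s + 1)) (j : ℕ) :
    br0 (j + 2) T (summand s x y) = 0 ∧
    br1 (j + 1) T (summand s x y) = if j = 1 then (4 * s + 2) • vac else 0 := by
  have hDx := D_mem_odd hx
  have hDDx := D_mem_even hDx
  -- both cases of left sesquilinearity at once; for `k = 0` the truncated `k - 1` is harmless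
  have l0 : ∀ (k : ℕ) (a c : W), br0 k (D a) c = -(k : ℂ) • br1 (k - 1) a c := fun k a c => by
    rcases k with _ | k
    · simp [br0_D_left_zero]
    · simp [br0_D_left_succ]
  have c0 := fun k => (hxy k).1
  have c1 := fun k => (hxy k).2
  have d0 := fun k => (hxy.br_D_even hx k).1
  have d1 := fun k => (hxy.br_D_even hx k).2
  have e0 := fun k => (hxy.br_DD_even hx k).1
  have e1 := fun k => (hxy.br_DD_even hx k).2
  simp only [summand, map_add, map_smul, wick0 _ _ hT hDDx, wick0 _ _ hT hx, wick0 _ _ hT hDx,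
    wick1 _ _ hT hDDx, wick1 _ _ hT hx, wick1 _ _ hT hDx, hTx.br0_eq, hTx.br1_eq, hTy.br0_eq,
    hTy.br1_eq, (hTx.br_D hT _).1, (hTx.br_D hT _).2, (hTx.br_DD hT _).1, (hTx.br_DD hT _).2,
    (hTy.br_D hT _).1, (hTy.br_D hT _).2, (hTy.br_DD hT _).1, (hTy.br_DD hT _).2]
  have hz : ∀ (m : ℕ) (f : ℕ → W), (∀ i, f i = 0) → ∑ i ∈ Finset.range m, f i = 0 :=
    fun m f hf => Finset.sum_eq_zero fun i _ => hf i
  constructor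
  · rw [hz _ _ fun i => ?_, hz _ _ fun i => ?_, hz _ _ fun i => ?_]
    · rcases j with _ | j
      · simp [sgn_zero]; module
      · simp
    all_goals
      rcases i with _ | _ | _ | i <;> simp [l0, br1_D_left, c1, d0, e1]
  · rcases j with _ | _ | j
    · simp [l0, br1_D_left, c0, d1, e0, sgn_zero, sgn_one]
    · simp [Finset.sum_range_succ, l0, br1_D_left, c0, d1, e0]
      module
    · rw [Finset.sum_eq_zero fun i _ => ?_, Finset.sum_eq_zero fun i _ => ?_,
        Finset.sum_eq_zero fun i _ => ?_]
      · simp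
      all_goals
        rcases i with _ | _ | i <;> simp [l0, br1_D_left, c0, d1, e0]

end Primary

/-! ### The modes `T_(0|0)`, `T_(0|1)`, `T_(1|0)` on words -/

section Modes

variable {A W : Type u} [AddCommGroup W] [Module ℂ W] [SUSYVertexAlgebra W]
  {par : A → ZMod 2} {φ ψ : A → W}

/-- A property of the letters and the vacuum that is stable under the product holds on words. -/
theorem IsWord.induction_letters {P : W → Prop} (vac : P vac)
    (φ_mem : ∀ a, P (φ a)) (ψ_mem : ∀ a, P (ψ a))
    (D_mem : ∀ b, P b → P (D b)) (mul : ∀ x w, P x → P w → P (mul x w))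
    {l : ℕ} {n : ℤ} {w : W} (hw : IsWord φ ψ l n w) : P w := by
  have hD : ∀ (e : ℕ) b, P b → P ((SUSYLieConformalAlgebra.D ^ e) b) := fun e b hb => by
    induction e with
    | zero => simpa using hb
    | succ e ih => rw [pow_succ']; exact D_mem _ ih
  induction hw with
  | nil => exact vac
  | cons hx _ ih =>
    refine mul _ _ ?_ ih
    cases hx with
    | fst e a => exact hD e _ (φ_mem a)
    | snd e a => exact hD e _ (ψ_mem a)

/-- `b` is homogeneous, `T_(0|0) b = 2∂b`, `T_(0|1) b = D b`, and `b` is an eigenvector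
of `T_(1|0)`. -/
def IsConformal (T b : W) : Prop :=
  (∃ p : ZMod 2, b ∈ gr p) ∧ br0 0 T b = (2 : ℂ) • D (D b) ∧ br1 0 T b = D b ∧
    ∃ μ : ℂ, br0 1 T b = μ • b

theorem IsPrimary.isConformal {T b : W} {w : ℂ} {p : ZMod 2} (hb : b ∈ gr p)
    (h : IsPrimary T b w) : IsConformal T b :=
  ⟨⟨p, hb⟩, by simp [h.br0_eq], by simp [h.br1_eq], w, by simp [h.br0_eq]⟩

theorem isConformal_vac {T : W} (hT : T ∈ gr 1) : IsConformal T vac :=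
  ⟨⟨0, vac_mem⟩, by simp [(br_vac_right _ hT).1, D_vac], by simp [(br_vac_right _ hT).2, D_vac],
    0, by simp [(br_vac_right _ hT).1]⟩

theorem IsConformal.map_D {T b : W} (hT : T ∈ gr 1) (h : IsConformal T b) :
    IsConformal T (D b) := by
  obtain ⟨⟨p, hp⟩, h0, h1, μ, hμ⟩ := h
  refine ⟨⟨p + 1, D_mem hp⟩, ?_, ?_, μ + 1, ?_⟩
  · rw [br0_D_right 0 b hT, h0, zmod_two_one_add_one]
    simp [sgn_zero]
  · rw [br1_D_right 0 b hT, h0, h1, zmod_two_one_add_one, sgn_zero]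
    module
  · rw [br0_D_right 1 b hT, hμ, h1, zmod_two_one_add_one, sgn_zero, map_smul]
    push_cast
    module

/-- `T_(1|0)` obeys the Leibniz rule: the integral in the Wick formula is the contraction
`(2∂b)_(0|1) c`, and the zeroth products of a derivative vanish. -/
theorem br0_one_mul {T b : W} {p : ZMod 2} (hT : T ∈ gr 1) (hb : b ∈ gr p)
    (h0 : br0 0 T b = (2 : ℂ) • SUSYLieConformalAlgebra.D (SUSYLieConformalAlgebra.D b)) (c : W) :
    br0 1 T (mul b c) = mul (br0 1 T b) c + mul b (br0 1 T c) := by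
  rw [wick0 1 c hT hb, zmod_two_one_add_one, zero_mul, sgn_zero]
  simp [h0, br1_D_left, br0_D_left_zero]

theorem IsConformal.map_mul {T b c : W} (hT : T ∈ gr 1) (hb : IsConformal T b)
    (hc : IsConformal T c) : IsConformal T (mul b c) := by
  obtain ⟨⟨p, hp⟩, h0, h1, μ, hμ⟩ := hb
  obtain ⟨⟨q, hq⟩, k0, k1, ν, hν⟩ := hc
  refine ⟨⟨p + q, mul_mem hp hq⟩, ?_, ?_, μ + ν, ?_⟩
  · have hs : sgn p * sgn (p + 1) = -1 := by
      rcases zmod_two_eq_zero_or_one p with rfl | rfl <;> simp [sgn_zero, sgn_one, zmod_two_one_add_one]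
    have hs' : sgn p * sgn p = 1 := by
      rcases zmod_two_eq_zero_or_one p with rfl | rfl <;> simp [sgn_zero, sgn_one]
    rw [wick0 0 c hT hp, h0, k0, zmod_two_one_add_one, zero_mul, sgn_zero, D_mul c hp, map_add,
      D_mul _ (D_mem hp), map_smul D, D_mul _ hp]
    simp only [smul_add, smul_smul, map_smul, LinearMap.smul_apply, Finset.range_zero,
      Finset.sum_empty, hs']
    have : sgn (p + 1) = - sgn p := by
      linear_combination (sgn p) * hs - (sgn (p + 1)) * hs'
    rw [this]
    module
  · rw [wick1 0 c hT hp, h1, k1, one_mul, D_mul c hp]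
    simp
  · rw [br0_one_mul hT hp h0, hμ, hν]
    simp only [map_smul, LinearMap.smul_apply]
    module

end Modes

/-! ### Spanning words of `F^ch` -/

namespace Fch

variable {A : Type u} {par : A → ZMod 2}

theorem isHom_id : IsHom (LinearMap.id : Fch par →ₗ[ℂ] Fch par) where
  map_gr h := h
  map_vac := rfl
  map_D _ := rfl
  map_mul _ _ := rfl
  map_br0 _ _ _ := rfl
  map_br1 _ _ _ := rfl

/-- `F^ch` is spanned by the words in its generators. -/
theorem span_words :
    Submodule.span ℂ {w : Fch par | ∃ (l : ℕ) (n : ℤ), IsWord (phi par) (psi par) l n w} = ⊤ := by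
  rw [eq_top_iff]
  intro x _
  induction x using induction with
  | zero => exact Submodule.zero_mem _
  | add x y hx hy => exact Submodule.add_mem _ (hx trivial) (hy trivial)
  | smul z s =>
    refine Submodule.smul_mem _ _ ?_
    have h := s.eval_fil (par := par) ⟨Fch par, phi par, psi par, isChargedFree⟩
    rw [show of s = s.eval (phi par) (psi par) from apply_of isHom_id s]
    refine Submodule.span_mono ?_ h
    rintro w ⟨l, n, _, _, hw⟩
    exact ⟨l, n, hw⟩

theorem isConformal_span {T : Fch par} (hT : T ∈ gr 1)
    (hφ : ∀ a, IsConformal T (phi par a)) (hψ : ∀ a, IsConformal T (psi par a)) :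
    Submodule.span ℂ {w : Fch par | IsConformal T w} = ⊤ := by
  rw [eq_top_iff, ← span_words]
  refine Submodule.span_mono ?_
  rintro w ⟨l, n, hw⟩
  exact hw.induction_letters (isConformal_vac hT) hφ hψ (fun _ h => h.map_D hT)
    fun _ _ h h' => h.map_mul hT h'

end Fch

/-! ### Commuting factors -/

section Exchange

variable {W : Type u} [AddCommGroup W] [Module ℂ W] [SUSYVertexAlgebra W]

theorem mul_comm_of_br1_eq_zero {p q : ZMod 2} {a b : W} (ha : a ∈ gr p) (hb : b ∈ gr q)
    (hpq : p * q = 0) (h : ∀ j, br1 j a b = 0) : mul a b = mul b a := by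
  have := quasi_comm 0 ha hb fun j _ => h j
  simpa [hpq, sgn_zero, sub_eq_zero] using this

/-- The factors of the three products in `summand` commute: the integral in quasi-commutativity
only sees the `χ`-part of the bracket, and all contractions involved are free of `χ`. -/
theorem summand_comm (s κ : ℂ) {x y : W} (hx : x ∈ gr 0) (hy : y ∈ gr 1)
    (h : IsContraction x y κ) :
    summand s x y = s • mul (D (D y)) x + (s + 1) • mul y (D (D x)) + mul (D y) (D x) := by
  have hDx := D_mem_odd hx
  have hDDx := D_mem_even hDx
  have hDy := D_mem_even hy
  have hDDy := D_mem_odd hDy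
  rw [summand, mul_comm_of_br1_eq_zero hDDx hy (by simp),
    mul_comm_of_br1_eq_zero hx hDDy (by simp) fun j => (h.br_DD_even hx j).2,
    mul_comm_of_br1_eq_zero hDx hDy (by simp)]
  · abel
  · intro j
    rw [br1_D_left, (h.br_D_even hx j).1]
  · intro j
    rw [br1_D_left]
    rcases j with _ | j
    · rw [br0_D_left_zero]
    · rw [br0_D_left_succ, (h j).2, smul_zero]

end Exchange

/-! ### Generators of fixed parity and the superconformal vector -/

section Generators

variable {A W : Type u} [AddCommGroup W] [Module ℂ W] [SUSYVertexAlgebra W]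
  {par : A → ZMod 2} {φ ψ : A → W}

variable (par φ ψ) in
/-- The even one among `φ_a`, `φ^ā`. -/
def evenGen (a : A) : W := if par a = 0 then φ a else ψ a

variable (par φ ψ) in
/-- The odd one among `φ_a`, `φ^ā`. -/
def oddGen (a : A) : W := if par a = 0 then ψ a else φ a

open Classical in
theorem IsChargedFree.contraction (H : IsChargedFree par φ ψ) (a b : A) :
    IsContraction (φ a) (ψ b) (if a = b then 1 else 0) := fun j => by
  refine ⟨?_, H.φψ_br1 a b j⟩
  by_cases hab : a = b
  · subst hab; simp [H.φψ_same]
  · simp [hab, H.φψ_ne a b j hab]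

open Classical in
theorem IsChargedFree.contraction_symm (H : IsChargedFree par φ ψ) (a b : A) :
    IsContraction (ψ a) (φ b) (if a = b then 1 else 0) := by
  have h := (H.contraction b a).symm (H.φ_mem b) (H.ψ_mem a) <| by
    by_cases hab : b = a
    · subst hab
      have : par b * (par b + 1) = 0 := by
        rcases zmod_two_eq_zero_or_one (par b) with h | h <;> rw [h] <;> rfl
      simp [this, sgn_zero]
    · simp [hab]
  simpa only [eq_comm] using h

theorem IsChargedFree.evenGen_mem (H : IsChargedFree par φ ψ) (a : A) :
    evenGen par φ ψ a ∈ gr (0 : ZMod 2) := by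
  rcases zmod_two_eq_zero_or_one (par a) with h | h
  · simpa [evenGen, h] using H.φ_mem a
  · simpa [evenGen, h, zmod_two_one_add_one] using H.ψ_mem a

theorem IsChargedFree.oddGen_mem (H : IsChargedFree par φ ψ) (a : A) :
    oddGen par φ ψ a ∈ gr (1 : ZMod 2) := by
  rcases zmod_two_eq_zero_or_one (par a) with h | h
  · simpa [oddGen, h] using H.ψ_mem a
  · simpa [oddGen, h] using H.φ_mem a

open Classical in
theorem IsChargedFree.evenGen_oddGen (H : IsChargedFree par φ ψ) (a b : A) :
    IsContraction (evenGen par φ ψ a) (oddGen par φ ψ b) (if a = b then 1 else 0) := by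
  unfold evenGen oddGen
  by_cases ha : par a = 0 <;> by_cases hb : par b = 0 <;> simp only [ha, hb, if_true, if_false]
  · exact H.contraction a b
  · rw [if_neg (by rintro rfl; exact hb ha)]
    intro j; simpa using H.φφ a b j
  · rw [if_neg (by rintro rfl; exact ha hb)]
    intro j; simpa using H.ψψ a b j
  · exact H.contraction_symm a b

theorem IsChargedFree.evenGen_evenGen (H : IsChargedFree par φ ψ) (a b : A) :
    IsContraction (evenGen par φ ψ a) (evenGen par φ ψ b) 0 := by
  classical
  have h1 := H.contraction a b
  have h2 := H.contraction_symm a b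
  unfold evenGen
  split_ifs with ha hb hb
  · intro j; simpa using H.φφ a b j
  · rwa [if_neg (by rintro rfl; exact hb ha)] at h1
  · rwa [if_neg (by rintro rfl; exact ha hb)] at h2
  · intro j; simpa using H.ψψ a b j

theorem IsChargedFree.oddGen_oddGen (H : IsChargedFree par φ ψ) (a b : A) :
    IsContraction (oddGen par φ ψ a) (oddGen par φ ψ b) 0 := by
  classical
  have h1 := H.contraction a b
  have h2 := H.contraction_symm a b
  unfold oddGen
  split_ifs with ha hb hb
  · intro j; simpa using H.ψψ a b j
  · rwa [if_neg (by rintro rfl; exact hb ha)] at h2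
  · rwa [if_neg (by rintro rfl; exact ha hb)] at h1
  · intro j; simpa using H.φφ a b j

variable [Fintype A]

variable (par φ ψ) in
/-- The shifted superconformal vector, written in the even and the odd generators. -/
noncomputable def superconformal (t : A → ℂ) : W :=
  ∑ a, summand (t a) (evenGen par φ ψ a) (oddGen par φ ψ a)


theorem IsChargedFree.superconformal_mem (H : IsChargedFree par φ ψ)
    (t : A → ℂ) : superconformal par φ ψ t ∈ gr (1 : ZMod 2) :=
  Submodule.sum_mem _ fun a _ => summand_mem _ (H.evenGen_mem a) (H.oddGen_mem a)

theorem IsChargedFree.isPrimary_evenGen (H : IsChargedFree par φ ψ)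
    (t : A → ℂ) (a : A) :
    IsPrimary (superconformal par φ ψ t) (evenGen par φ ψ a) (-t a) := by
  classical
  refine isPrimary_of_even _ (H.superconformal_mem t) (H.evenGen_mem a) fun j => ?_
  have h := fun b => br_even_summand (t b) _ (H.evenGen_mem a) (H.evenGen_mem b)
    (H.evenGen_evenGen a b) (H.evenGen_oddGen a b) j
  simp only [superconformal, map_sum, fun b => (h b).1, fun b => (h b).2]
  rcases j with _ | _ | j <;> simp [ite_smul]

theorem IsChargedFree.isPrimary_oddGen (H : IsChargedFree par φ ψ)
    (t : A → ℂ) (a : A) :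
    IsPrimary (superconformal par φ ψ t) (oddGen par φ ψ a) (t a + 1) := by
  classical
  refine isPrimary_of_odd _ (H.superconformal_mem t) (H.oddGen_mem a) fun j => ?_
  have hc : ∀ b, IsContraction (oddGen par φ ψ a) (evenGen par φ ψ b) (if b = a then 1 else 0) :=
    fun b => (H.evenGen_oddGen b a).symm (H.evenGen_mem b) (H.oddGen_mem a) (by simp [sgn_zero])
  have h := fun b => br_odd_summand (t b) _ (H.oddGen_mem a) (H.evenGen_mem b)
    (hc b) (H.oddGen_oddGen a b) j
  simp only [superconformal, map_sum, fun b => (h b).1, fun b => (h b).2]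
  rcases j with _ | _ | j <;> simp [ite_smul]

theorem IsChargedFree.isConformal_fst (H : IsChargedFree par φ ψ)
    (t : A → ℂ) (a : A) : IsConformal (superconformal par φ ψ t) (φ a) := by
  by_cases ha : par a = 0
  · simpa [evenGen, ha] using (H.isPrimary_evenGen t a).isConformal (H.evenGen_mem a)
  · simpa [oddGen, ha] using (H.isPrimary_oddGen t a).isConformal (H.oddGen_mem a)

theorem IsChargedFree.isConformal_snd (H : IsChargedFree par φ ψ)
    (t : A → ℂ) (a : A) : IsConformal (superconformal par φ ψ t) (ψ a) := by
  by_cases ha : par a = 0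
  · simpa [oddGen, ha] using (H.isPrimary_oddGen t a).isConformal (H.oddGen_mem a)
  · simpa [evenGen, ha] using (H.isPrimary_evenGen t a).isConformal (H.evenGen_mem a)

theorem IsChargedFree.br0_one_superconformal (H : IsChargedFree par φ ψ)
    (t : A → ℂ) :
    br0 1 (superconformal par φ ψ t) (superconformal par φ ψ t) =
      (3 : ℂ) • superconformal par φ ψ t := by
  have hT := H.superconformal_mem t
  conv_lhs => enter [2]; rw [superconformal]
  conv_rhs => rw [superconformal]
  rw [map_sum, Finset.smul_sum]
  refine Finset.sum_congr rfl fun a _ => ?_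
  have hx := H.evenGen_mem a
  have hTx := H.isPrimary_evenGen t a
  have hTy := H.isPrimary_oddGen t a
  simp only [summand, map_add, map_smul]
  rw [br0_one_mul hT hx (by simp [hTx.br0_eq]),
    br0_one_mul hT (D_mem_odd hx) (by simp [(hTx.br_D hT _).1]),
    br0_one_mul hT (D_mem_even (D_mem_odd hx)) (by simp [(hTx.br_DD hT _).1])]
  simp only [hTx.br0_eq, (hTx.br_D hT _).1, (hTx.br_DD hT _).1, hTy.br0_eq, (hTy.br_D hT _).1,
    (hTy.br_DD hT _).1, one_ne_zero, if_false, if_true, map_smul, LinearMap.smul_apply]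
  module

theorem IsChargedFree.br_superconformal (H : IsChargedFree par φ ψ)
    (t : A → ℂ) (j : ℕ) :
    br0 (j + 2) (superconformal par φ ψ t) (superconformal par φ ψ t) = 0 ∧
    br1 (j + 1) (superconformal par φ ψ t) (superconformal par φ ψ t) =
      if j = 1 then (∑ a, (4 * t a + 2)) • vac else 0 := by
  have h := fun a => br_summand (t a) (H.superconformal_mem t) (H.evenGen_mem a)
    (by simpa using H.evenGen_oddGen a a) (H.isPrimary_evenGen t a) (H.isPrimary_oddGen t a) j
  have h0 : ∀ (f : W →ₗ[ℂ] W), f (superconformal par φ ψ t) =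
      ∑ a, f (summand (t a) (evenGen par φ ψ a) (oddGen par φ ψ a)) := fun f => by
    rw [superconformal, map_sum]
  rw [h0 (br0 (j + 2) _), h0 (br1 (j + 1) _)]
  simp only [(h _).1, (h _).2]
  constructor
  · simp
  · split_ifs
    · rw [Finset.sum_smul]
    · simp

end Generators

/-! ### The vector `T^ch_sh` -/

namespace Fch

variable {A : Type u} [Fintype A] (par : A → ZMod 2) (t : A → ℂ)

theorem Tsh_eq_superconformal : Tsh par t = superconformal par (phi par) (psi par) t := by
  have H := isChargedFree (par := par)
  rw [Tsh, superconformal, Finset.sum_filter, Finset.sum_filter, ← Finset.sum_add_distrib]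
  refine Finset.sum_congr rfl fun a _ => ?_
  rcases zmod_two_eq_zero_or_one (par a) with ha | ha
  · simp [ha, evenGen, oddGen, summand, del_apply]
  · have h := summand_comm (t a) _ (H.evenGen_mem a) (H.oddGen_mem a) (H.evenGen_oddGen a a)
    rw [h]
    simp [ha, evenGen, oddGen, del_apply]

theorem Tsh_zero : Tsh par (fun _ => 0) = Tst par := by
  simp [Tsh, Tst]

theorem isSuperconformalVector_Tsh :
    IsSuperconformalVector (Tsh par t) (∑ a, (6 * t a + 3)) := by
  have H := isChargedFree (par := par)
  rw [Tsh_eq_superconformal]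
  have hT := H.superconformal_mem t
  have hspan := isConformal_span hT (H.isConformal_fst t) (H.isConformal_snd t)
  have h00 : br0 0 (superconformal par (phi par) (psi par) t) = (2 : ℂ) • del :=
    LinearMap.ext_on hspan fun w hw => hw.2.1
  have h01 : br1 0 (superconformal par (phi par) (psi par) t) = D :=
    LinearMap.ext_on hspan fun w hw => hw.2.2.1
  refine ⟨hT, fun j => ?_, fun j => ?_, h00, h01, ?_⟩
  · rcases j with _ | _ | j
    · rw [h00]; simp
    · simpa using H.br0_one_superconformal t
    · simpa using (H.br_superconformal t j).1
  · rcases j with _ | j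
    · rw [h01]; simp
    · rw [(H.br_superconformal t j).2]
      have hc : ∑ a, (4 * t a + 2) = 2 * ((∑ a, (6 * t a + 3)) / 3) := by
        rw [Finset.sum_div, Finset.mul_sum]
        exact Finset.sum_congr rfl fun a _ => by ring
      rw [hc]
      simp
  · rw [eq_top_iff, ← hspan, Submodule.span_le]
    rintro w ⟨-, -, -, μ, hμ⟩
    exact Submodule.mem_iSup_of_mem μ (Module.End.mem_eigenspace_iff.2 hμ)

end Fch

end SUSYVertexAlgebra

theorem theorem4p6 {A : Type u} [Fintype A] (par : A → ZMod 2) (t : A → ℂ) :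
    SUSYVertexAlgebra.IsSuperconformalVector (SUSYVertexAlgebra.Fch.Tsh par t)
        (∑ a, (6 * t a + 3)) ∧
      SUSYVertexAlgebra.Fch.Tsh par (fun _ => 0) = SUSYVertexAlgebra.Fch.Tst par :=
  ⟨SUSYVertexAlgebra.Fch.isSuperconformalVector_Tsh par t, SUSYVertexAlgebra.Fch.Tsh_zero par⟩
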